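/- Let $M_n = M_n(\mathbb{C})$ be the algebra of complex $n \times n$ matrices. An operator system (or quantum graph) in $M_n$ is a complex linear subspace $\mathcal V \subseteq M_n$ such that $I_n \in \mathcal V$ and $A^* \in \mathcal V$ for all $A \in \mathcal V$. For a positive integer $k$, a $k$-anticlique of $\mathcal V$ is an orthogonal projection $P \in M_n$ (that is, $P = P^2 = P^*$) of rank $k$ such that $P \mathcal V P = \mathrm{span}\{P\}$, where $P\mathcal V P = \{PAP : A \in \mathcal V\}$. Let $\ell$ be a nonnegative integer, let $n$ and $k$ be positive integers, and let $\mathcal V \subseteq M_n$ be an operator system. Then: (1) if $\dim_{\mathbb{C}} \mathcal V \leq 2\ell + 1$ and $n > 3^\ell (k-1)$, then $\mathcal V$ has a $k$-anticlique; (2) if $\dim_{\mathbb{C}} \mathcal V \leq 2\ell + 2$ and $n > 2 \cdot 3^\ell (k-1)$, then $\mathcal V$ has a $k$-anticlique. -/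

import Mathlib

/-- An operator system (quantum graph) in `M_n(ℂ)`: a complex linear subspace that contains the
identity matrix and is closed under the conjugate transpose. -/
structure IsOperatorSystem {n : ℕ} (V : Submodule ℂ (Matrix (Fin n) (Fin n) ℂ)) : Prop where
  one_mem : (1 : Matrix (Fin n) (Fin n) ℂ) ∈ V
  conjTranspose_mem : ∀ A ∈ V, A.conjTranspose ∈ V

/-- An anticlique of `V`: an orthogonal projection `P` with `P V P = span {P}`. -/
structure IsAnticlique {n : ℕ} (V : Submodule ℂ (Matrix (Fin n) (Fin n) ℂ))
    (P : Matrix (Fin n) (Fin n) ℂ) : Prop where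
  isStarProjection : IsStarProjection P
  compression_eq : (fun A => P * A * P) '' (V : Set (Matrix (Fin n) (Fin n) ℂ)) =
    (Submodule.span ℂ {P} : Set (Matrix (Fin n) (Fin n) ℂ))

/-- `V` has a `k`-anticlique: an anticlique of rank `k`. -/
def HasAnticlique {n : ℕ} (V : Submodule ℂ (Matrix (Fin n) (Fin n) ℂ)) (k : ℕ) : Prop :=
  ∃ P : Matrix (Fin n) (Fin n) ℂ, IsAnticlique V P ∧ P.rank = k

/-! An operator system is spanned by the identity and Hermitian matrices, at most `2ℓ` in case (1)
and `2ℓ + 1` in case (2). It suffices to find a `k`-dimensional subspace on which each of them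
compresses to a scalar. The matrices are treated two at a time: a pair can be made scalar on a
`k`-dimensional subspace once the dimension exceeds `3 (k - 1)` (`exists_isScalarOn_pair`), a single
one once it exceeds `2 (k - 1)`. Compressing to that subspace and repeating multiplies these
factors.

For a pair `X, Y`, Helly's theorem in the plane (`exists_common_point`) yields scalars such that,
after subtracting them, no real combination of `X` and `Y` is negative definite on a subspace of
codimension less than `k`. The core is `exists_isotropic_of_pencilIndexGE`: such a pencil has a
`k`-dimensional subspace on which both forms vanish. If some eigenvector of the pencil is isotropic
for both forms, it is split off, and the index drops by only one (`PencilIndexGE.compress`).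
Otherwise the pencil is diagonal in a suitable basis, with entries `(x i, y i)` in the plane, none
zero and no two in opposite directions.

In the diagonal case, rotate the plane so that no `x i` is zero and the number of negative `x i` is
least, then sort by the slopes `t i = y i / x i`. Minimality bounds the initial sums of the signs of
`x i`, so the indices split into classes with alternating signs, each beginning and ending with
`+1`. On a class with `r` negative signs, take suitably weighted values at the nodes of polynomials
of degree less than `r`. Both forms become top divided differences of polynomials of too low degree,
hence vanish. The weights are real because the signs alternate, and the dimensions `r` add up to the
number of negative signs. -/

/-! ### Splitting sign sequences -/

/-- A `±1` sequence whose initial sums all lie in `[0, D]` can be split into `D` subsequences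
whose initial sums all lie in `{0, 1}`. -/
theorem exists_coloring_sum_mem {ι : Type*} [LinearOrder ι] (D : ℕ) (ε : ι → ℤ)
    (hε : ∀ i, ε i = 1 ∨ ε i = -1) (s : Finset ι)
    (h : ∀ u ⊆ s, (∀ i ∈ u, ∀ j ∈ s, j ≤ i → j ∈ u) → 0 ≤ ∑ i ∈ u, ε i ∧ ∑ i ∈ u, ε i ≤ D) :
    ∃ c : ι → ℕ, (∀ i ∈ s, c i < D) ∧ ∀ q < D, ∀ u ⊆ s, (∀ i ∈ u, ∀ j ∈ s, j ≤ i → j ∈ u) →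
      0 ≤ ∑ i ∈ u with c i = q, ε i ∧ ∑ i ∈ u with c i = q, ε i ≤ 1 := by
  classical
  induction s using Finset.induction_on_max with
  | empty =>
    refine ⟨fun _ => 0, by simp, fun q _ u hu _ => ?_⟩
    rw [Finset.subset_empty.1 hu]; simp
  | insert a s has ih =>
    have ha : a ∉ s := fun h' => lt_irrefl _ (has a h')
    obtain ⟨c, hc, hq⟩ := ih fun u hu hlow => h u (hu.trans (Finset.subset_insert _ _)) (by
      intro i hi j hj hji
      rcases Finset.mem_insert.1 hj with rfl | hj
      · exact absurd (has i (hu hi)) (not_lt.2 hji)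
      · exact hlow i hi j hj hji)
    have hsum : ∑ q ∈ Finset.range D, ∑ i ∈ s with c i = q, ε i = ∑ i ∈ s, ε i :=
      Finset.sum_fiberwise_of_maps_to (fun i hi => Finset.mem_range.2 (hc i hi)) _
    have hS := h (insert a s) subset_rfl (fun _ _ j hj _ => hj)
    rw [Finset.sum_insert ha] at hS
    have hsq : ∀ q < D, 0 ≤ ∑ i ∈ s with c i = q, ε i ∧ ∑ i ∈ s with c i = q, ε i ≤ 1 :=
      fun q hqD => hq q hqD s subset_rfl fun _ _ j hj _ => hj
    -- The class totals are 0 or 1 and add up to the current sum. If no class could take `a`, all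
    -- totals would be 1 (for sign `+1`) or all 0 (for `-1`), and the next sum would leave `[0, D]`.
    have key : ∃ q < D, 0 ≤ ε a + ∑ i ∈ s with c i = q, ε i ∧
        ε a + ∑ i ∈ s with c i = q, ε i ≤ 1 := by
      by_contra! hcon
      rcases hε a with h1 | h1
      · have : ∑ q ∈ Finset.range D, (1 : ℤ) ≤ ∑ q ∈ Finset.range D, ∑ i ∈ s with c i = q, ε i :=
          Finset.sum_le_sum fun q hqD => by
            have := hcon q (Finset.mem_range.1 hqD)
            have := hsq q (Finset.mem_range.1 hqD)
            omega
        simp at this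
        omega
      · have : ∑ q ∈ Finset.range D, ∑ i ∈ s with c i = q, ε i ≤ ∑ q ∈ Finset.range D, (0 : ℤ) :=
          Finset.sum_le_sum fun q hqD => by
            have := hcon q (Finset.mem_range.1 hqD)
            have := hsq q (Finset.mem_range.1 hqD)
            by_contra hlt
            omega
        simp at this
        omega
    obtain ⟨q₀, hq₀, hq₀'⟩ := key
    have hupd : ∀ u ⊆ s, ∀ q, (u.filter fun i => Function.update c a q₀ i = q) =
        u.filter fun i => c i = q := by
      intro u hu q
      refine Finset.filter_congr fun i hi => ?_
      rw [Function.update_of_ne]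
      rintro rfl
      exact ha (hu hi)
    refine ⟨Function.update c a q₀, ?_, ?_⟩
    · intro i hi
      rcases Finset.mem_insert.1 hi with rfl | hi
      · simpa using hq₀
      · rw [Function.update_of_ne (ne_of_mem_of_not_mem hi ha)]
        exact hc i hi
    · intro q hqD u hu hlow
      by_cases hau : a ∈ u
      · have : u = insert a s := by
          refine Finset.Subset.antisymm hu fun j hj => hlow a hau j hj ?_
          rcases Finset.mem_insert.1 hj with rfl | hj
          · exact le_rfl
          · exact (has j hj).le
        subst this
        rw [Finset.filter_insert, hupd s subset_rfl]
        by_cases hqq : q₀ = q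
        · subst hqq
          simp only [Function.update_self, if_true]
          rw [Finset.sum_insert (by simp [ha])]
          exact hq₀'
        · simp only [Function.update_self, hqq, if_false]
          exact hsq q hqD
      · have hus : u ⊆ s := fun i hi =>
          (Finset.mem_insert.1 (hu hi)).resolve_left (by rintro rfl; exact hau hi)
        rw [hupd u hus]
        exact hq q hqD u hus fun i hi j hj hji => hlow i hi j (Finset.mem_insert_of_mem hj) hji

theorem even_sum_sub_card {ι : Type*} (ε : ι → ℤ) (hε : ∀ i, ε i = 1 ∨ ε i = -1)
    (s : Finset ι) : Even (∑ i ∈ s, ε i - s.card) := by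
  have : ∑ i ∈ s, ε i - s.card = ∑ i ∈ s, (ε i - 1) := by simp
  rw [this]
  refine Finset.even_sum _ fun i _ => ?_
  rcases hε i with h | h <;> rw [h] <;> decide

/-! ### Alternating signs and divided differences -/

section Alternating

variable {ι : Type*} [LinearOrder ι] {ε : ι → ℤ} {t : ι → ℝ} {Q : Finset ι}

/-- Two tied nodes, and everything between them, carry the same sign, so two initial sums would
differ by at least 2, while all of them lie in `{0, 1}`. -/
theorem lt_of_alternating (hε : ∀ i, ε i = 1 ∨ ε i = -1) (ht : Monotone t)
    (htie : ∀ i j, t i = t j → ε i = ε j)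
    (hQ : ∀ u ⊆ Q, (∀ i ∈ u, ∀ j ∈ Q, j ≤ i → j ∈ u) → 0 ≤ ∑ i ∈ u, ε i ∧ ∑ i ∈ u, ε i ≤ 1)
    {i j : ι} (hi : i ∈ Q) (hj : j ∈ Q) (hij : i < j) : t i < t j := by
  refine lt_of_le_of_ne (ht hij.le) fun heq => ?_
  have h1 := hQ (Q.filter (· < i)) (Finset.filter_subset _ _) (by
    intro a ha b hb hba
    simp only [Finset.mem_filter] at ha ⊢
    exact ⟨hb, hba.trans_lt ha.2⟩)
  have h2 := hQ (Q.filter (· ≤ j)) (Finset.filter_subset _ _) (by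
    intro a ha b hb hba
    simp only [Finset.mem_filter] at ha ⊢
    exact ⟨hb, hba.trans ha.2⟩)
  have hsub : Q.filter (· < i) ⊆ Q.filter (· ≤ j) := by
    intro a ha
    simp only [Finset.mem_filter] at ha ⊢
    exact ⟨ha.1, (ha.2.trans hij).le⟩
  have hsplit := Finset.sum_sdiff (f := ε) hsub
  have hconst : ∑ a ∈ Q.filter (· ≤ j) \ Q.filter (· < i), ε a =
      ((Q.filter (· ≤ j) \ Q.filter (· < i)).card : ℤ) * ε i := by
    rw [Finset.sum_congr rfl (g := fun _ => ε i), Finset.sum_const, nsmul_eq_mul]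
    intro a ha
    simp only [Finset.mem_sdiff, Finset.mem_filter, not_and, not_lt] at ha
    refine htie _ _ (le_antisymm ?_ (ht (ha.2 ha.1.1)))
    rw [heq]
    exact ht ha.1.2
  have hcard : 2 ≤ (Q.filter (· ≤ j) \ Q.filter (· < i)).card := by
    rw [← Finset.card_pair hij.ne]
    refine Finset.card_le_card fun a ha => ?_
    simp only [Finset.mem_insert, Finset.mem_singleton] at ha
    simp only [Finset.mem_sdiff, Finset.mem_filter, not_and, not_lt]
    rcases ha with rfl | rfl
    · exact ⟨⟨hi, hij.le⟩, fun _ => le_rfl⟩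
    · exact ⟨⟨hj, le_rfl⟩, fun _ => hij.le⟩
  rcases hε i with h | h <;> rw [h] at hconst <;> omega

/-- The product has sign `(-1)` to the number of nodes above `i`. Alternation with total 1 makes
that number even when `ε i = 1` and odd when `ε i = -1`. -/
theorem mul_prod_sub_pos_of_alternating (hε : ∀ i, ε i = 1 ∨ ε i = -1) (ht : Monotone t)
    (htie : ∀ i j, t i = t j → ε i = ε j)
    (hQ : ∀ u ⊆ Q, (∀ i ∈ u, ∀ j ∈ Q, j ≤ i → j ∈ u) → 0 ≤ ∑ i ∈ u, ε i ∧ ∑ i ∈ u, ε i ≤ 1)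
    (hQ1 : ∑ i ∈ Q, ε i = 1) {i : ι} (hi : i ∈ Q) :
    0 < (ε i : ℝ) * ∏ j ∈ Q.erase i, (t i - t j) := by
  have hlt := fun {a b : ι} => lt_of_alternating (i := a) (j := b) hε ht htie hQ
  have hprod : ∏ j ∈ Q.erase i, (t i - t j) =
      (∏ j ∈ Q with j < i, (t i - t j)) * ∏ j ∈ Q with i < j, (t i - t j) := by
    rw [← Finset.prod_union]
    · congr 1
      ext a
      simp only [Finset.mem_erase, Finset.mem_union, Finset.mem_filter]
      rw [← and_or_left, ← lt_or_lt_iff_ne, and_comm]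
    · rw [Finset.disjoint_filter]
      intro a _ h1 h2
      exact lt_asymm h1 h2
  have hpos : 0 < ∏ j ∈ Q with j < i, (t i - t j) := Finset.prod_pos fun j hj => by
    simp only [Finset.mem_filter] at hj
    exact sub_pos.2 (hlt hj.1 hi hj.2)
  have hneg : ∏ j ∈ Q with i < j, (t i - t j) =
      (-1) ^ (Q.filter (i < ·)).card * ∏ j ∈ Q with i < j, (t j - t i) := by
    rw [← Finset.prod_const, ← Finset.prod_mul_distrib]
    exact Finset.prod_congr rfl fun j _ => by ring
  have hpos' : 0 < ∏ j ∈ Q with i < j, (t j - t i) := Finset.prod_pos fun j hj => by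
    simp only [Finset.mem_filter] at hj
    exact sub_pos.2 (hlt hi hj.1 hj.2)
  have hsign : ((-1 : ℝ)) ^ (Q.filter (i < ·)).card = ε i := by
    have h1 := hQ (Q.filter (· < i)) (Finset.filter_subset _ _) (by
      intro a ha b hb hba
      simp only [Finset.mem_filter] at ha ⊢
      exact ⟨hb, hba.trans_lt ha.2⟩)
    have h2 := hQ (Q.filter (· ≤ i)) (Finset.filter_subset _ _) (by
      intro a ha b hb hba
      simp only [Finset.mem_filter] at ha ⊢
      exact ⟨hb, hba.trans ha.2⟩)
    have h3 : Q.filter (· ≤ i) = insert i (Q.filter (· < i)) := by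
      ext a
      simp only [Finset.mem_insert, Finset.mem_filter, le_iff_eq_or_lt]
      constructor
      · rintro ⟨h, rfl | h'⟩
        · exact Or.inl rfl
        · exact Or.inr ⟨h, h'⟩
      · rintro (rfl | h)
        · exact ⟨hi, Or.inl rfl⟩
        · exact ⟨h.1, Or.inr h.2⟩
    have h4 := Finset.sum_filter_add_sum_filter_not Q (· ≤ i) ε
    simp only [not_le] at h4
    rw [h3, Finset.sum_insert (by simp)] at h2 h4
    obtain ⟨m, hm⟩ := even_sum_sub_card ε hε (Q.filter (i < ·))
    rcases hε i with h | h
    · have : Even (Q.filter (i < ·)).card := by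
        rw [← Int.even_coe_nat]
        exact ⟨-m, by omega⟩
      rw [h, this.neg_one_pow]; norm_num
    · have : Odd (Q.filter (i < ·)).card := by
        rw [← Int.odd_coe_nat]
        exact ⟨-m, by omega⟩
      rw [h, this.neg_one_pow]; norm_num
  have hsq : (ε i : ℝ) * ε i = 1 := by
    rcases hε i with h | h <;> rw [h] <;> norm_num
  rw [hprod, hneg, hsign]
  have : (ε i : ℝ) * ((∏ j ∈ Q with j < i, (t i - t j)) *
      (ε i * ∏ j ∈ Q with i < j, (t j - t i))) = (ε i : ℝ) * ε i *
      ((∏ j ∈ Q with j < i, (t i - t j)) * ∏ j ∈ Q with i < j, (t j - t i)) := by ring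
  rw [this, hsq, one_mul]
  positivity

end Alternating

theorem card_eq_of_sum_eq_one {ι : Type*} {ε : ι → ℤ} (hε : ∀ i, ε i = 1 ∨ ε i = -1)
    {Q : Finset ι} (hQ1 : ∑ i ∈ Q, ε i = 1) : Q.card = 2 * (Q.filter (ε · = -1)).card + 1 := by
  have h : ∑ i ∈ Q, ε i = ∑ i ∈ Q, (1 - 2 * if ε i = -1 then 1 else 0) :=
    Finset.sum_congr rfl fun i _ => by rcases hε i with h | h <;> simp [h]
  rw [hQ1, Finset.sum_sub_distrib, ← Finset.mul_sum, Finset.sum_boole] at h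
  simp at h
  omega

/-- By Lagrange interpolation the sum is the coefficient of degree `2r` of the polynomial `conj p *
q * X ^ e`, whose degree is at most `2 (r - 1) + 1`. -/
theorem sum_div_prod_sub_eq_zero {n : ℕ} {t : Fin n → ℝ} {Q : Finset (Fin n)}
    (ht : Set.InjOn t Q) {r : ℕ} (hr : Q.card = 2 * r + 1) {p q : Polynomial ℂ}
    (hp : p.degree < r) (hq : q.degree < r) {e : ℕ} (he : e ≤ 1) :
    ∑ i ∈ Q, (starRingEnd ℂ) (p.eval (t i : ℂ)) * q.eval (t i : ℂ) * (t i : ℂ) ^ e /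
      ((∏ j ∈ Q.erase i, (t i - t j) : ℝ) : ℂ) = 0 := by
  rcases Nat.eq_zero_or_pos r with rfl | hrpos
  · have : p = 0 := by
      rw [← Polynomial.degree_eq_bot]
      simpa using hp
    simp [this]
  set P : Polynomial ℂ := p.map (starRingEnd ℂ) * q * Polynomial.X ^ e with hP
  have hnat : ∀ f : Polynomial ℂ, f.degree < r → f.natDegree < r := by
    intro f hf
    rcases eq_or_ne f 0 with rfl | h0
    · simpa using hrpos
    · exact (Polynomial.natDegree_lt_iff_degree_lt h0).2 hf
  have hpn := hnat p hp
  have hqn := hnat q hq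
  have hPn : P.natDegree < Q.card - 1 := by
    have h1 : P.natDegree ≤ _ := Polynomial.natDegree_mul_le
    have h2 : (p.map (starRingEnd ℂ) * q).natDegree ≤ _ := Polynomial.natDegree_mul_le
    have h3 : (p.map (starRingEnd ℂ)).natDegree ≤ p.natDegree := Polynomial.natDegree_map_le
    have h4 : ((Polynomial.X : Polynomial ℂ) ^ e).natDegree ≤ e := Polynomial.natDegree_X_pow_le e
    omega
  have hinj : Set.InjOn (fun i => (t i : ℂ)) Q := fun i hi j hj h =>
    ht hi hj (Complex.ofReal_injective h)
  have hdeg : P.degree < Q.card := by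
    refine lt_of_le_of_lt Polynomial.degree_le_natDegree ?_
    exact_mod_cast (by omega : P.natDegree < Q.card)
  have h := Lagrange.coeff_eq_sum hinj hdeg
  rw [Polynomial.coeff_eq_zero_of_natDegree_lt hPn] at h
  rw [h]
  refine Finset.sum_congr rfl fun i _ => ?_
  have hc : (p.map (starRingEnd ℂ)).eval (t i : ℂ) = (starRingEnd ℂ) (p.eval (t i : ℂ)) := by
    rw [← Polynomial.eval_map_apply, Complex.conj_ofReal]
  simp [hP, hc]

/-! ### Isotropic subspaces of diagonal pencils -/

/-- The coordinate space of a diagonal Hermitian pencil `(x, y)`, sorted by the ratio `y / x`,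
whose combinations all have at least as many negative entries as `x`, contains a subspace of that
dimension on which both forms vanish. -/
theorem exists_isotropic_of_sorted {n k : ℕ} (x y : Fin n → ℝ) (hx : ∀ i, x i ≠ 0)
    (hneg : (Finset.univ.filter fun i => x i < 0).card = k)
    (hsort : Monotone fun i => y i / x i)
    (htie : ∀ i j, x i < 0 → 0 < x j → y i / x i ≠ y j / x j)
    (hidx : ∀ α β : ℝ, (∀ i, α * x i + β * y i ≠ 0) →
      k ≤ (Finset.univ.filter fun i => α * x i + β * y i < 0).card) :
    ∃ L : Submodule ℂ (Fin n → ℂ), Module.finrank ℂ L = k ∧ ∀ f ∈ L, ∀ g ∈ L,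
      ∑ i, (starRingEnd ℂ) (f i) * g i * (x i : ℂ) = 0 ∧
      ∑ i, (starRingEnd ℂ) (f i) * g i * (y i : ℂ) = 0 := by
  classical
  set t : Fin n → ℝ := fun i => y i / x i with ht
  set ε : Fin n → ℤ := fun i => if x i < 0 then -1 else 1 with hεdef
  have hε : ∀ i, ε i = 1 ∨ ε i = -1 := fun i => by
    simp only [hεdef]; split_ifs <;> simp
  have hεneg : ∀ i, ε i = -1 ↔ x i < 0 := fun i => by
    simp only [hεdef]; split_ifs with h <;> simp [h]
  have hεx : ∀ i, 0 < (ε i : ℝ) * x i := fun i => by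
    simp only [hεdef]; split_ifs with h
    · push_cast; linarith
    · push_cast; linarith [lt_of_le_of_ne (not_lt.1 h) (hx i).symm]
  have htie' : ∀ i j, t i = t j → ε i = ε j := by
    intro i j hij
    simp only [hεdef]
    split_ifs with h1 h2 h2
    · rfl
    · exact absurd hij (htie i j h1 (lt_of_le_of_ne (not_lt.1 h2) (hx j).symm))
    · exact absurd hij.symm (htie j i h2 (lt_of_le_of_ne (not_lt.1 h1) (hx i).symm))
    · rfl
  have hyt : ∀ i, y i = x i * t i := fun i => by
    simp only [ht]; field_simp [hx i]
  have htot : ∑ i, ε i = n - 2 * k := by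
    have : ∑ i, ε i = ∑ i, (1 - 2 * if x i < 0 then 1 else 0 : ℤ) :=
      Finset.sum_congr rfl fun i _ => by simp only [hεdef]; split_ifs <;> simp
    rw [this, Finset.sum_sub_distrib, ← Finset.mul_sum, Finset.sum_boole, hneg]
    simp
  -- bounds at generic thresholds
  have hgen : ∀ s : ℝ, (∀ i, t i ≠ s) → 0 ≤ ∑ i with t i < s, ε i ∧
      ∑ i with t i < s, ε i ≤ n - 2 * k := by
    intro s hs
    have hcalc : ∀ σ : ℝ, (σ = 1 ∨ σ = -1) → ∀ i, (σ * s) * x i + (-σ) * y i =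
        σ * (x i * (s - t i)) := fun σ _ i => by rw [hyt]; ring
    have hne : ∀ σ : ℝ, (σ = 1 ∨ σ = -1) → ∀ i, (σ * s) * x i + (-σ) * y i ≠ 0 := by
      intro σ hσ i
      rw [hcalc σ hσ]
      refine mul_ne_zero (by rcases hσ with rfl | rfl <;> norm_num)
        (mul_ne_zero (hx i) (sub_ne_zero.2 (hs i).symm))
    have hF : ∑ i with t i < s, ε i = ∑ i, if t i < s then ε i else 0 := Finset.sum_filter _ _
    have hcount : ∀ i, x i * (s - t i) < 0 ↔ ¬ (0 < x i * (s - t i)) := fun i => by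
      rw [not_lt, le_iff_lt_or_eq, or_iff_left]
      exact mul_ne_zero (hx i) (sub_ne_zero.2 (hs i).symm)
    have hpt : ∀ i, (2 * if x i * (s - t i) < 0 then 1 else 0 : ℤ) =
        1 - (2 * (if t i < s then ε i else 0) - ε i) := by
      intro i
      rcases lt_or_gt_of_ne (hs i) with h1 | h1 <;> rcases lt_or_gt_of_ne (hx i) with h2 | h2
      · rw [if_pos (mul_neg_of_neg_of_pos h2 (by linarith)), if_pos h1, (hεneg i).2 h2]; norm_num
      · rw [if_neg (not_lt.2 (mul_pos h2 (by linarith)).le), if_pos h1]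
        simp [hεdef, not_lt.2 h2.le]
      · rw [if_neg (not_lt.2 (mul_pos_of_neg_of_neg h2 (by linarith)).le), if_neg (not_lt.2 h1.le),
          (hεneg i).2 h2]; norm_num
      · rw [if_pos (mul_neg_of_pos_of_neg h2 (by linarith)), if_neg (not_lt.2 h1.le)]
        simp [hεdef, not_lt.2 h2.le]
    -- With `F` the sum of signs below `s`, the combination `s x - y` has `n - k - F` negative
    -- entries and its opposite has `k + F`. Both counts are at least `k`, which gives the two
    -- bounds.
    have hsum : 2 * ((Finset.univ.filter fun i => x i * (s - t i) < 0).card : ℤ) =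
        n - (2 * ∑ i with t i < s, ε i - (n - 2 * k)) := by
      have := Finset.sum_congr (rfl : (Finset.univ : Finset (Fin n)) = Finset.univ)
        fun i _ => hpt i
      rw [← Finset.mul_sum, Finset.sum_boole, Finset.sum_sub_distrib, Finset.sum_sub_distrib,
        ← Finset.mul_sum, ← hF, htot] at this
      simpa using this
    have hcompl : (Finset.univ.filter fun i => x i * (s - t i) < 0).card +
        (Finset.univ.filter fun i => 0 < x i * (s - t i)).card = n := by
      have := Finset.card_filter_add_card_filter_not (s := (Finset.univ : Finset (Fin n)))
        (fun i => 0 < x i * (s - t i))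
      simp only [hcount]
      simp only [Finset.card_univ, Fintype.card_fin] at this
      omega
    have h1 := hidx _ _ (hne 1 (Or.inl rfl))
    have h2 := hidx _ _ (hne (-1) (Or.inr rfl))
    simp_rw [hcalc 1 (Or.inl rfl), one_mul] at h1
    simp_rw [hcalc (-1) (Or.inr rfl), neg_one_mul, Left.neg_neg_iff] at h2
    constructor <;> omega
  -- bounds for all initial segments
  have hbound : ∀ u ⊆ (Finset.univ : Finset (Fin n)),
      (∀ i ∈ u, ∀ j ∈ (Finset.univ : Finset (Fin n)), j ≤ i → j ∈ u) →
      0 ≤ ∑ i ∈ u, ε i ∧ ∑ i ∈ u, ε i ≤ ((n - 2 * k : ℕ) : ℤ) := by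
    have hD : ((n - 2 * k : ℕ) : ℤ) = n - 2 * k := by
      obtain ⟨s, hs⟩ := (Set.finite_range t).infinite_compl.nonempty
      have := hgen s fun i hi => hs ⟨i, hi⟩
      omega
    rw [hD]
    intro u _ hlow
    by_cases hu : u = Finset.univ
    · subst hu
      obtain ⟨s, hs⟩ := (Set.finite_range t).infinite_compl.nonempty
      have := hgen s fun i hi => hs ⟨i, hi⟩
      omega
    obtain ⟨b, hb, hbmin⟩ : ∃ b ∉ u, ∀ i ∉ u, b ≤ i := by
      have hne : (uᶜ).Nonempty := by
        rw [Finset.nonempty_iff_ne_empty, Ne, Finset.compl_eq_empty_iff]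
        exact hu
      exact ⟨(uᶜ).min' hne, Finset.mem_compl.1 (Finset.min'_mem _ hne),
        fun i hi => Finset.min'_le _ _ (Finset.mem_compl.2 hi)⟩
    have hle : ∀ i ∈ u, t i ≤ t b := fun i hi => hsort (by
      by_contra hcon
      exact hb (hlow i hi b (Finset.mem_univ _) (not_le.1 hcon).le))
    have hge : ∀ i ∉ u, t b ≤ t i := fun i hi => hsort (hbmin i hi)
    -- Generic thresholds just below and just above `t b` enclose `u`. The indices between them are
    -- all tied with `b` and share its sign, so the sum over `u` lies between two sums already
    -- bounded.
    obtain ⟨s₁, hs₁, hs₁'⟩ : ∃ s, s < t b ∧ ∀ i, t i < t b → t i < s := by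
      have h1 : ∀ᶠ s in nhdsWithin (t b) (Set.Iio (t b)), ∀ i, t i < t b → t i < s := by
        refine Filter.eventually_all.2 fun i => ?_
        by_cases h : t i < t b
        · filter_upwards [mem_nhdsWithin_of_mem_nhds (lt_mem_nhds h)] with s hs _ using hs
        · exact Filter.Eventually.of_forall fun s h' => absurd h' h
      exact (h1.and self_mem_nhdsWithin).exists.imp fun _ h => h.symm
    obtain ⟨s₂, hs₂, hs₂'⟩ : ∃ s, t b < s ∧ ∀ i, t b < t i → s < t i := by
      have h1 : ∀ᶠ s in nhdsWithin (t b) (Set.Ioi (t b)), ∀ i, t b < t i → s < t i := by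
        refine Filter.eventually_all.2 fun i => ?_
        by_cases h : t b < t i
        · filter_upwards [mem_nhdsWithin_of_mem_nhds (gt_mem_nhds h)] with s hs _ using hs
        · exact Filter.Eventually.of_forall fun s h' => absurd h' h
      exact (h1.and self_mem_nhdsWithin).exists.imp fun _ h => h.symm
    have hg₁ := hgen s₁ fun i hi => by
      rcases lt_or_ge (t i) (t b) with h | h
      · exact (hs₁' i h).ne hi
      · exact (hs₁.trans_le h).ne' hi
    have hg₂ := hgen s₂ fun i hi => by
      rcases lt_or_ge (t b) (t i) with h | h
      · exact (hs₂' i h).ne' hi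
      · exact (h.trans_lt hs₂).ne hi
    have hsub₁ : (Finset.univ.filter fun i => t i < s₁) ⊆ u := fun i hi => by
      by_contra h
      exact absurd (hge i h) (not_le.2 ((Finset.mem_filter.1 hi).2.trans hs₁))
    have hsub₂ : u ⊆ Finset.univ.filter fun i => t i < s₂ := fun i hi =>
      Finset.mem_filter.2 ⟨Finset.mem_univ _, (hle i hi).trans_lt hs₂⟩
    have hsp₁ := Finset.sum_sdiff (f := ε) hsub₁
    have hsp₂ := Finset.sum_sdiff (f := ε) hsub₂
    have hc₁ : ∑ i ∈ u \ Finset.univ.filter (fun i => t i < s₁), ε i =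
        ((u \ Finset.univ.filter (fun i => t i < s₁)).card : ℤ) * ε b := by
      rw [Finset.sum_congr rfl (g := fun _ => ε b), Finset.sum_const, nsmul_eq_mul]
      intro i hi
      simp only [Finset.mem_sdiff, Finset.mem_filter, Finset.mem_univ, true_and] at hi
      refine htie' _ _ ((hle i hi.1).antisymm ?_)
      by_contra h
      exact hi.2 (hs₁' i (not_le.1 h))
    have hc₂ : ∑ i ∈ Finset.univ.filter (fun i => t i < s₂) \ u, ε i =
        ((Finset.univ.filter (fun i => t i < s₂) \ u).card : ℤ) * ε b := by
      rw [Finset.sum_congr rfl (g := fun _ => ε b), Finset.sum_const, nsmul_eq_mul]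
      intro i hi
      simp only [Finset.mem_sdiff, Finset.mem_filter, Finset.mem_univ, true_and] at hi
      refine htie' _ _ (le_antisymm ?_ (hge i hi.2))
      by_contra h
      exact lt_asymm hi.1 (hs₂' i (not_le.1 h))
    rcases hε b with h | h <;> rw [h] at hc₁ hc₂ <;> constructor <;> omega
  have hDcast : ((n - 2 * k : ℕ) : ℤ) = ∑ i, ε i := by
    have := hbound Finset.univ subset_rfl fun _ _ _ _ _ => Finset.mem_univ _
    omega
  obtain ⟨c, hcD, hc⟩ := exists_coloring_sum_mem (n - 2 * k) ε hε Finset.univ hbound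
  set Q : ℕ → Finset (Fin n) := fun q => Finset.univ.filter fun i => c i = q with hQdef
  have hQlow : ∀ q < n - 2 * k, ∀ u ⊆ Q q, (∀ i ∈ u, ∀ j ∈ Q q, j ≤ i → j ∈ u) →
      0 ≤ ∑ i ∈ u, ε i ∧ ∑ i ∈ u, ε i ≤ 1 := by
    intro q hq u hu hlow
    have hcq : ∀ i ∈ u, c i = q := fun i hi => (Finset.mem_filter.1 (hu hi)).2
    -- An initial segment of a class is the trace on that class of its down-closure among all
    -- indices, to which the coloring bound applies.
    have heq : (Finset.univ.filter fun i => ∃ j ∈ u, i ≤ j).filter (fun i => c i = q) = u := by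
      ext i
      simp only [Finset.mem_filter, Finset.mem_univ, true_and]
      constructor
      · rintro ⟨⟨j, hj, hij⟩, hi⟩
        exact hlow j hj i (Finset.mem_filter.2 ⟨Finset.mem_univ _, hi⟩) hij
      · exact fun hi => ⟨⟨i, hi, le_rfl⟩, hcq i hi⟩
    rw [← heq]
    refine hc q hq _ (Finset.subset_univ _) fun i hi j _ hji => ?_
    simp only [Finset.mem_filter, Finset.mem_univ, true_and] at hi ⊢
    obtain ⟨a, ha, hia⟩ := hi
    exact ⟨a, ha, hji.trans hia⟩
  have hQ1 : ∀ q < n - 2 * k, ∑ i ∈ Q q, ε i = 1 := by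
    have hle1 : ∀ q ∈ Finset.range (n - 2 * k), ∑ i ∈ Q q, ε i ≤ 1 := fun q hq =>
      (hQlow q (Finset.mem_range.1 hq) (Q q) subset_rfl fun _ _ j hj _ => hj).2
    have hsum : ∑ q ∈ Finset.range (n - 2 * k), ∑ i ∈ Q q, ε i =
        ∑ q ∈ Finset.range (n - 2 * k), 1 := by
      -- The `n - 2k` class sums are each at most 1 and total `n - 2k`, so equality holds in every
      -- class.
      rw [Finset.sum_fiberwise_of_maps_to (fun i hi => Finset.mem_range.2 (hcD i hi)), ← hDcast]
      simp
    intro q hq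
    exact (Finset.sum_eq_sum_iff_of_le hle1).1 hsum q (Finset.mem_range.2 hq)
  set π : Fin n → ℝ := fun i => ∏ j ∈ (Q (c i)).erase i, (t i - t j) with hπ
  have hiQ : ∀ i, i ∈ Q (c i) := fun i => Finset.mem_filter.2 ⟨Finset.mem_univ _, rfl⟩
  have hπx : ∀ i, 0 < x i * π i := by
    intro i
    have h1 := mul_prod_sub_pos_of_alternating hε hsort htie'
      (hQlow (c i) (hcD i (Finset.mem_univ _))) (hQ1 _ (hcD i (Finset.mem_univ _))) (hiQ i)
    have h2 := mul_pos (hεx i) h1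
    have h3 : (ε i : ℝ) * ε i = 1 := by rcases hε i with h | h <;> rw [h] <;> norm_num
    have h4 : (ε i : ℝ) * x i * ((ε i : ℝ) * π i) = (ε i : ℝ) * ε i * (x i * π i) := by ring
    change 0 < (ε i : ℝ) * x i * ((ε i : ℝ) * π i) at h2
    rwa [h4, h3, one_mul] at h2
  -- The weight is chosen so that `w² x = 1 / π`, which turns the weighted forms into divided
  -- differences; positivity of `x π` makes it real.
  set w : Fin n → ℝ := fun i => Real.sqrt (x i * π i)⁻¹ with hw
  have hwpos : ∀ i, 0 < w i := fun i => Real.sqrt_pos.2 (inv_pos.2 (hπx i))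
  have hwx : ∀ i, w i * w i * x i = (π i)⁻¹ := fun i => by
    have hπ0 : π i ≠ 0 := right_ne_zero_of_mul (hπx i).ne'
    rw [hw]
    simp only
    rw [Real.mul_self_sqrt (inv_pos.2 (hπx i)).le]
    field_simp [hx i]
  set N : ℕ → Finset (Fin n) := fun q => (Q q).filter fun i => ε i = -1 with hN
  have hinj : ∀ q < n - 2 * k, Set.InjOn t (Q q) := by
    intro q hq i hi j hj hij
    by_contra hne
    rcases lt_or_gt_of_ne hne with h | h
    · exact (lt_of_alternating hε hsort htie' (hQlow q hq) hi hj h).ne hij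
    · exact (lt_of_alternating hε hsort htie' (hQlow q hq) hj hi h).ne' hij
  have hinjN : ∀ q < n - 2 * k, Set.InjOn (fun i => (t i : ℂ)) (N q) := fun q hq i hi j hj hij =>
    hinj q hq (Finset.mem_filter.1 hi).1 (Finset.mem_filter.1 hj).1 (Complex.ofReal_injective hij)
  let G : ℕ → (Fin n → ℂ) →ₗ[ℂ] Polynomial ℂ := fun q =>
    Lagrange.interpolate (N q) fun i => (t i : ℂ)
  -- Values prescribed at the negative indices are interpolated in each class, and the resulting
  -- polynomial is evaluated at all nodes of that class.
  let Φ : ({i // x i < 0} → ℂ) →ₗ[ℂ] (Fin n → ℂ) :=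
    (LinearMap.pi fun i => (w i : ℂ) • (Polynomial.leval (t i : ℂ) ∘ₗ G (c i))) ∘ₗ
      Function.ExtendByZero.linearMap ℂ Subtype.val
  have hΦ : ∀ u i, Φ u i = (w i : ℂ) *
      (G (c i) (Function.extend Subtype.val u 0)).eval (t i : ℂ) := fun u i => rfl
  have hΦinj : Function.Injective Φ := by
    rw [injective_iff_map_eq_zero]
    intro u hu
    ext ⟨i, hi⟩
    have h1 : Φ u i = 0 := by rw [hu]; rfl
    have hiN : i ∈ N (c i) := Finset.mem_filter.2 ⟨hiQ i, (hεneg i).2 hi⟩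
    rw [hΦ, Lagrange.eval_interpolate_at_node (v := fun i => (t i : ℂ)) _
      (hinjN _ (hcD i (Finset.mem_univ _))) hiN] at h1
    have h2 : Function.extend Subtype.val u 0 i = u ⟨i, hi⟩ :=
      Subtype.val_injective.extend_apply u 0 ⟨i, hi⟩
    rw [h2] at h1
    exact (mul_eq_zero.1 h1).resolve_left (by exact_mod_cast (hwpos i).ne')
  have hzero : ∀ u v : {i // x i < 0} → ℂ, ∀ e ≤ 1,
      ∑ i, (starRingEnd ℂ) (Φ u i) * Φ v i * ((x i : ℂ) * (t i : ℂ) ^ e) = 0 := by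
    intro u v e he
    rw [← Finset.sum_fiberwise_of_maps_to (t := Finset.range (n - 2 * k)) (g := c)
      (fun i hi => Finset.mem_range.2 (hcD i hi))]
    refine Finset.sum_eq_zero fun q hq => ?_
    have hq' := Finset.mem_range.1 hq
    have hdeg : ∀ z, (G q z).degree < ((N q).card : ℕ) := fun z =>
      Lagrange.degree_interpolate_lt _ (hinjN q hq')
    rw [← sum_div_prod_sub_eq_zero (hinj q hq') (card_eq_of_sum_eq_one hε (hQ1 q hq'))
      (hdeg (Function.extend Subtype.val u 0)) (hdeg (Function.extend Subtype.val v 0)) he]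
    refine Finset.sum_congr rfl fun i hi => ?_
    have hiq : c i = q := (Finset.mem_filter.1 hi).2
    have h1 : ((w i * w i * x i : ℝ) : ℂ) = ((π i)⁻¹ : ℝ) := by rw [hwx]
    rw [hΦ, hΦ, hiq]
    have h2 : (∏ j ∈ (Q q).erase i, (t i - t j)) = π i := by rw [hπ, ← hiq]
    rw [h2, div_eq_mul_inv, ← Complex.ofReal_inv, ← h1]
    simp only [map_mul, Complex.conj_ofReal, Complex.ofReal_mul]
    ring
  refine ⟨LinearMap.range Φ, ?_, ?_⟩
  · rw [LinearMap.finrank_range_of_inj hΦinj, Module.finrank_fintype_fun_eq_card,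
      Fintype.card_subtype, hneg]
  · rintro _ ⟨u, rfl⟩ _ ⟨v, rfl⟩
    constructor
    · simpa using hzero u v 0 (by norm_num)
    · have := hzero u v 1 le_rfl
      simp only [pow_one] at this
      rw [← this]
      refine Finset.sum_congr rfl fun i _ => ?_
      rw [hyt]
      push_cast
      ring

theorem Submodule.exists_le_finrank_eq {K V : Type*} [DivisionRing K] [AddCommGroup V]
    [Module K V] [FiniteDimensional K V] (L : Submodule K V) {k : ℕ}
    (hk : k ≤ Module.finrank K L) : ∃ M ≤ L, Module.finrank K M = k := by
  obtain ⟨f, hf⟩ := exists_linearIndependent_of_le_finrank hk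
  have hf' : LinearIndependent K (L.subtype ∘ f) :=
    hf.map' L.subtype (Submodule.ker_subtype L)
  refine ⟨Submodule.span K (Set.range (L.subtype ∘ f)), ?_, ?_⟩
  · rw [Submodule.span_le]
    rintro _ ⟨i, rfl⟩
    exact (f i).2
  · rw [finrank_span_eq_card hf', Fintype.card_fin]

/-- Isotropy for both forms is unchanged by an invertible linear change of the pair of forms, so the
plane may be turned to a generic direction with fewest negative entries. This supplies the
minimality that the sorted case requires. -/
theorem exists_isotropic_of_diagonal {n k : ℕ} (x y : Fin n → ℝ)
    (hanti : ∀ i j, ∀ a b : ℝ, 0 < a → 0 < b →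
      ¬(a * x i + b * x j = 0 ∧ a * y i + b * y j = 0))
    (hidx : ∀ α β : ℝ, (Finset.univ.filter fun i => α * x i + β * y i < 0).card + k ≤ n) :
    ∃ L : Submodule ℂ (Fin n → ℂ), Module.finrank ℂ L = k ∧ ∀ f ∈ L, ∀ g ∈ L,
      ∑ i, (starRingEnd ℂ) (f i) * g i * (x i : ℂ) = 0 ∧
      ∑ i, (starRingEnd ℂ) (f i) * g i * (y i : ℂ) = 0 := by
  classical
  set S : Set (ℝ × ℝ) := {d | ∀ i, d.1 * x i + d.2 * y i ≠ 0} with hS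
  set c : ℝ × ℝ → ℕ := fun d =>
    (Finset.univ.filter fun i => d.1 * x i + d.2 * y i < 0).card with hc
  have hne : S.Nonempty := by
    have hfin : (⋃ i, {s : ℝ | x i + s * y i = 0}).Finite := by
      refine Set.finite_iUnion fun i => Set.Subsingleton.finite ?_
      intro s hs s' hs'
      simp only [Set.mem_ofPred_eq] at hs hs'
      rcases eq_or_ne (y i) 0 with h | h
      · refine absurd ⟨?_, ?_⟩ (hanti i i 1 1 one_pos one_pos)
        · rw [h] at hs; linarith
        · rw [h]; ring
      · exact mul_right_cancel₀ h (by linarith)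
    obtain ⟨s, hs⟩ := hfin.infinite_compl.nonempty
    exact ⟨(1, s), fun i hi => hs (Set.mem_iUnion.2 ⟨i, by simpa using hi⟩)⟩
  obtain ⟨⟨α, β⟩, hd, hmin⟩ := (measure c).wf.has_min S hne
  have hmin' : ∀ d ∈ S, c (α, β) ≤ c d := fun d hd => not_lt.1 (hmin d hd)
  -- No entry vanishes in this direction, so the nonnegative entries are the negative ones of the
  -- opposite direction, to which `hidx` applies.
  have hkc : k ≤ c (α, β) := by
    have h1 := hidx (-α) (-β)
    have h2 := Finset.card_filter_add_card_filter_not (s := (Finset.univ : Finset (Fin n)))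
      (fun i => α * x i + β * y i < 0)
    have h3 : (Finset.univ.filter fun i => ¬ α * x i + β * y i < 0) =
        Finset.univ.filter fun i => -α * x i + -β * y i < 0 := by
      refine Finset.filter_congr fun i _ => ?_
      have := hd i
      simp only at this
      rw [not_lt, le_iff_lt_or_eq, or_iff_left this.symm]
      constructor <;> intro h <;> linarith
    rw [h3] at h2
    simp only [Finset.card_univ, Fintype.card_fin] at h2
    simp only [hc]
    omega
  set x' : Fin n → ℝ := fun i => α * x i + β * y i with hx'
  set y' : Fin n → ℝ := fun i => -β * x i + α * y i with hy'
  set σ : Equiv.Perm (Fin n) := Tuple.sort fun i => y' i / x' i with hσ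
  have hcard : ∀ p : Fin n → Prop, (Finset.univ.filter fun i => p (σ i)).card =
      (Finset.univ.filter fun i => p i).card := fun p =>
    Finset.card_equiv σ (by simp)
  have hnorm : ∀ i : Fin n, α * α + β * β ≠ 0 := by
    intro i h
    have hα : α = 0 := by nlinarith [mul_self_nonneg α, mul_self_nonneg β]
    have hβ : β = 0 := by nlinarith [mul_self_nonneg α, mul_self_nonneg β]
    exact hd i (by simp [hα, hβ])
  obtain ⟨L, hL, hLiso⟩ := exists_isotropic_of_sorted (k := c (α, β)) (x' ∘ σ) (y' ∘ σ)
    (fun i => hd (σ i)) (hcard fun i => x' i < 0)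
    (Tuple.monotone_sort fun i => y' i / x' i) (by
      intro i j hi hj h
      simp only [Function.comp_apply] at hi hj h
      have hi' := hi.ne
      have hj' := hj.ne'
      rw [div_eq_div_iff hi' hj'] at h
      have hN := hnorm i
      have h1 : x' (σ j) * x' (σ i) + -x' (σ i) * x' (σ j) = 0 := by ring
      have h2 : x' (σ j) * y' (σ i) + -x' (σ i) * y' (σ j) = 0 := by linarith
      -- Equal slopes with opposite signs of `x'` mean opposite vectors in the plane; the factor `α²
      -- + β²` undoes the rotation.
      refine hanti (σ i) (σ j) (x' (σ j)) (-x' (σ i)) hj (by linarith) ⟨?_, ?_⟩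
      · refine (mul_eq_zero.1 (?_ : (α * α + β * β) * _ = 0)).resolve_left hN
        calc _ = α * (x' (σ j) * x' (σ i) + -x' (σ i) * x' (σ j)) -
              β * (x' (σ j) * y' (σ i) + -x' (σ i) * y' (σ j)) := by
              simp only [hx', hy']; ring
          _ = 0 := by rw [h1, h2]; ring
      · refine (mul_eq_zero.1 (?_ : (α * α + β * β) * _ = 0)).resolve_left hN
        calc _ = β * (x' (σ j) * x' (σ i) + -x' (σ i) * x' (σ j)) +
              α * (x' (σ j) * y' (σ i) + -x' (σ i) * y' (σ j)) := by
              simp only [hx', hy']; ring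
          _ = 0 := by rw [h1, h2]; ring) (by
      intro γ δ h
      have hcomb : ∀ i, γ * x' i + δ * y' i = (γ * α - δ * β) * x i + (γ * β + δ * α) * y i :=
        fun i => by simp only [hx', hy']; ring
      have h1 : (γ * α - δ * β, γ * β + δ * α) ∈ S := fun i => by
        have := h (σ.symm i)
        simp only [Function.comp_apply, Equiv.apply_symm_apply] at this
        rwa [hcomb] at this
      refine (hmin' _ h1).trans (le_of_eq ?_)
      refine Eq.trans ?_ (hcard fun i => γ * x' i + δ * y' i < 0).symm
      simp_rw [hcomb]
      rfl)
  obtain ⟨M, hML, hM⟩ := L.exists_le_finrank_eq (hkc.trans hL.ge)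
  refine ⟨M.map (LinearEquiv.funCongrLeft ℂ ℂ σ.symm).toLinearMap, ?_, ?_⟩
  · rw [← hM]
    exact LinearEquiv.finrank_map_eq _ M
  · rintro _ ⟨f, hf, rfl⟩ _ ⟨g, hg, rfl⟩
    obtain ⟨h1, h2⟩ := hLiso f (hML hf) g (hML hg)
    have hre : ∀ z : Fin n → ℝ, ∑ i, (starRingEnd ℂ) ((LinearEquiv.funCongrLeft ℂ ℂ σ.symm) f i) *
        (LinearEquiv.funCongrLeft ℂ ℂ σ.symm) g i * (z i : ℂ) =
        ∑ i, (starRingEnd ℂ) (f i) * g i * (z (σ i) : ℂ) := fun z => by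
      rw [← Equiv.sum_comp σ]
      refine Finset.sum_congr rfl fun i _ => ?_
      simp [LinearEquiv.funCongrLeft_apply, LinearMap.funLeft_apply]
    simp only [LinearEquiv.coe_coe]
    rw [hre, hre]
    rcases isEmpty_or_nonempty (Fin n) with hemp | ⟨⟨i₀⟩⟩
    · simp
    have hN : ((α * α + β * β : ℝ) : ℂ) ≠ 0 := by exact_mod_cast hnorm i₀
    constructor
    · refine (mul_eq_zero.1 (?_ : ((α * α + β * β : ℝ) : ℂ) * _ = 0)).resolve_left hN
      calc _ = (α : ℂ) * (∑ i, (starRingEnd ℂ) (f i) * g i * ((x' ∘ σ) i : ℂ)) -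
            β * (∑ i, (starRingEnd ℂ) (f i) * g i * ((y' ∘ σ) i : ℂ)) := by
            rw [Finset.mul_sum, Finset.mul_sum, Finset.mul_sum, ← Finset.sum_sub_distrib]
            refine Finset.sum_congr rfl fun i _ => ?_
            simp only [hx', hy', Function.comp_apply]; push_cast; ring
        _ = 0 := by rw [h1, h2]; ring
    · refine (mul_eq_zero.1 (?_ : ((α * α + β * β : ℝ) : ℂ) * _ = 0)).resolve_left hN
      calc _ = (β : ℂ) * (∑ i, (starRingEnd ℂ) (f i) * g i * ((x' ∘ σ) i : ℂ)) +
            α * (∑ i, (starRingEnd ℂ) (f i) * g i * ((y' ∘ σ) i : ℂ)) := by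
            rw [Finset.mul_sum, Finset.mul_sum, Finset.mul_sum, ← Finset.sum_add_distrib]
            refine Finset.sum_congr rfl fun i _ => ?_
            simp only [hx', hy', Function.comp_apply]; push_cast; ring
        _ = 0 := by rw [h1, h2]; ring

/-! ### Compressions and simultaneous diagonalization -/

section Compression

variable {V : Type*} [NormedAddCommGroup V] [InnerProductSpace ℂ V] [FiniteDimensional ℂ V]

/-- The compression of an operator to a subspace. -/
noncomputable def Submodule.compress (W : Submodule ℂ V) (X : V →ₗ[ℂ] V) : W →ₗ[ℂ] W :=
  W.orthogonalProjectionOnto.toLinearMap ∘ₗ X ∘ₗ W.subtype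

theorem Submodule.inner_compress (W : Submodule ℂ V) (X : V →ₗ[ℂ] V) (u w : W) :
    inner ℂ u (W.compress X w) = inner ℂ (u : V) (X w) :=
  Submodule.inner_orthogonalProjectionOnto_eq_of_mem_left u (X w)

theorem LinearMap.IsSymmetric.compress {X : V →ₗ[ℂ] V} (hX : X.IsSymmetric)
    (W : Submodule ℂ V) : (W.compress X).IsSymmetric := fun u w => by
  rw [W.inner_compress, ← inner_conj_symm, W.inner_compress, inner_conj_symm]
  exact hX u w

end Compression

theorem finrank_span_pair_le_one {V : Type*} [AddCommGroup V] [Module ℂ V] {a b : V} {p q : ℂ}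
    (hpq : ¬(p = 0 ∧ q = 0)) (h : p • a + q • b = 0) :
    Module.finrank ℂ (Submodule.span ℂ {a, b}) ≤ 1 := by
  have hone : ∀ c : V, Module.finrank ℂ (Submodule.span ℂ {c}) ≤ 1 := fun c => by
    simpa using finrank_span_le_card (R := ℂ) ({c} : Set V)
  by_cases hp : p = 0
  · have hq : q ≠ 0 := fun hq => hpq ⟨hp, hq⟩
    have hb : b = 0 := by
      rw [hp, zero_smul, zero_add] at h
      exact (smul_eq_zero.1 h).resolve_left hq
    rw [hb, Set.pair_comm, Submodule.span_insert_zero]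
    exact hone a
  · have ha : a ∈ Submodule.span ℂ {b} := by
      rw [Submodule.mem_span_singleton]
      refine ⟨-(p⁻¹ * q), ?_⟩
      have : p • a = -(q • b) := eq_neg_of_add_eq_zero_left h
      rw [neg_smul, mul_smul, ← smul_neg, ← this, smul_smul, inv_mul_cancel₀ hp, one_smul]
    rw [Submodule.span_insert_eq_span ha]
    exact hone b

section Pencil

/-- No common eigenvector of the pencil spanned by `X` and `Y` is isotropic for both forms. -/
def NoIsotropicEigenvector {V : Type*} [NormedAddCommGroup V] [InnerProductSpace ℂ V]
    (X Y : V →ₗ[ℂ] V) : Prop :=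
  ∀ v : V, v ≠ 0 → ∀ p q : ℂ, ¬(p = 0 ∧ q = 0) → p • X v + q • Y v = 0 →
    ¬(inner ℂ v (X v) = 0 ∧ inner ℂ v (Y v) = 0)

/-- A kernel vector of `X + iY` would be an isotropic eigenvector, since the real and imaginary
parts of its form are the two real forms. So `X + iY` is invertible, and an eigenvector of `(X +
iY)⁻¹ (X - iY)` is an eigenvector of the pencil. -/
theorem exists_pencil_eigenvector {V : Type*} [NormedAddCommGroup V] [InnerProductSpace ℂ V]
    [FiniteDimensional ℂ V] [Nontrivial V] {X Y : V →ₗ[ℂ] V} (hX : X.IsSymmetric)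
    (hY : Y.IsSymmetric) (h : NoIsotropicEigenvector X Y) :
    ∃ v : V, v ≠ 0 ∧ ∃ p q : ℂ, ¬(p = 0 ∧ q = 0) ∧ p • X v + q • Y v = 0 := by
  have hinj : Function.Injective (X + Complex.I • Y) := by
    rw [injective_iff_map_eq_zero]
    intro v hv
    by_contra hv0
    refine h v hv0 1 Complex.I (by simp) (by simpa using hv) ?_
    have h1 : inner ℂ v (X v) + Complex.I * inner ℂ v (Y v) = 0 := by
      rw [← inner_smul_right, ← inner_add_right]
      have : X v + Complex.I • Y v = 0 := by simpa using hv
      rw [this, inner_zero_right]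
    rw [← hX.coe_re_inner_self_apply, ← hY.coe_re_inner_self_apply] at h1 ⊢
    have hre := congrArg Complex.re h1
    have him := congrArg Complex.im h1
    simp at hre him
    constructor <;> simp [hre, him]
  set A := LinearEquiv.ofInjectiveEndo _ hinj with hA
  obtain ⟨c, hc⟩ := Module.End.exists_eigenvalue
    (A.symm.toLinearMap ∘ₗ (X - Complex.I • Y) : Module.End ℂ V)
  obtain ⟨v, hv⟩ := hc.exists_hasEigenvector
  refine ⟨v, hv.2, 1 - c, -Complex.I * (1 + c), ?_, ?_⟩
  · rintro ⟨h1, h2⟩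
    have hc1 : c = 1 := by linear_combination -h1
    rw [hc1] at h2
    have := congrArg Complex.im h2
    norm_num at this
  · have h1 := hv.apply_eq_smul
    simp only [LinearMap.comp_apply, LinearEquiv.coe_coe] at h1
    rw [LinearEquiv.symm_apply_eq, map_smul] at h1
    have h2 : A v = X v + Complex.I • Y v := by
      rw [hA, LinearEquiv.coe_ofInjectiveEndo]; simp
    rw [h2] at h1
    simp only [LinearMap.sub_apply, LinearMap.smul_apply] at h1
    have h3 : (1 - c) • X v + (-Complex.I * (1 + c)) • Y v =
        X v - Complex.I • Y v - c • (X v + Complex.I • Y v) := by module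
    rw [h3, h1, sub_self]

/-- For a pencil eigenvector `v`, the vectors `X v` and `Y v` span a line `U`. Since `v` is not
isotropic for both forms, it lies outside `Uᗮ`, which is a hyperplane orthogonal to `v` for both
forms; the induction continues there. The basis diagonalizes by congruence and need not be
orthogonal. -/
theorem exists_simultaneous_diagonalization (n : ℕ) : ∀ (V : Type*) [NormedAddCommGroup V]
    [InnerProductSpace ℂ V] [FiniteDimensional ℂ V] (X Y : V →ₗ[ℂ] V),
    Module.finrank ℂ V = n → X.IsSymmetric → Y.IsSymmetric → NoIsotropicEigenvector X Y →
    ∃ e : Fin n → V, (∀ i j, i ≠ j → inner ℂ (e i) (X (e j)) = 0 ∧ inner ℂ (e i) (Y (e j)) = 0) ∧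
      ∀ i, ¬(inner ℂ (e i) (X (e i)) = 0 ∧ inner ℂ (e i) (Y (e i)) = 0) := by
  induction n with
  | zero => exact fun V _ _ _ X Y _ _ _ _ => ⟨Fin.elim0, fun i => i.elim0, fun i => i.elim0⟩
  | succ n ih =>
    intro V _ _ _ X Y hn hX hY h
    have : Nontrivial V := Module.nontrivial_of_finrank_pos (R := ℂ) (by omega)
    obtain ⟨v, hv0, p, q, hpq, hv⟩ := exists_pencil_eigenvector hX hY h
    have hviso := h v hv0 p q hpq hv
    set U := Submodule.span ℂ {X v, Y v} with hU
    have hU1 : Module.finrank ℂ U = 1 := by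
      refine le_antisymm (finrank_span_pair_le_one hpq hv) ?_
      rw [Nat.one_le_iff_ne_zero, Ne, Submodule.finrank_eq_zero, hU, Submodule.span_eq_bot]
      intro h0
      exact hviso ⟨by rw [h0 (X v) (by simp), inner_zero_right],
        by rw [h0 (Y v) (by simp), inner_zero_right]⟩
    have hmem : ∀ w, w ∈ Uᗮ ↔ inner ℂ (X v) w = 0 ∧ inner ℂ (Y v) w = 0 := by
      intro w
      rw [Submodule.mem_orthogonal]
      constructor
      · exact fun hw => ⟨hw _ (Submodule.subset_span (by simp)),
          hw _ (Submodule.subset_span (by simp))⟩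
      · rintro ⟨h1, h2⟩ u hu
        obtain ⟨a, b, rfl⟩ := Submodule.mem_span_pair.1 hu
        rw [inner_add_left, inner_smul_left, inner_smul_left, h1, h2]
        simp
    have hWn : Module.finrank ℂ Uᗮ = n := by
      have := U.finrank_add_finrank_orthogonal
      omega
    have hvW : v ∉ Uᗮ := fun hvW => by
      rw [hmem, hX v v, hY v v] at hvW
      exact hviso hvW
    -- A vector orthogonal to `Uᗮ` lies on the line `U`; were it nonzero and orthogonal to `v`, all
    -- of `U` would be orthogonal to `v`. This lifts eigenvectors of the compressed pencil to `V`.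
    have htop : ∀ z : V, (∀ w ∈ Uᗮ, inner ℂ w z = 0) → inner ℂ v z = 0 → z = 0 := by
      intro z hz hvz
      have h1 : z ∈ U := by
        rw [← U.orthogonal_orthogonal]
        exact hz
      obtain ⟨a, b, rfl⟩ := Submodule.mem_span_pair.1 h1
      by_contra hne
      have hspan : Submodule.span ℂ {a • X v + b • Y v} = U := by
        refine Submodule.eq_of_le_of_finrank_eq ?_ ?_
        · rw [Submodule.span_singleton_le_iff_mem]; exact h1
        · rw [finrank_span_singleton hne, hU1]
      refine hviso ?_
      have hin : ∀ y ∈ U, inner ℂ v y = 0 := by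
        intro y hy
        rw [← hspan, Submodule.mem_span_singleton] at hy
        obtain ⟨c, rfl⟩ := hy
        rw [inner_smul_right, hvz, mul_zero]
      exact ⟨hin _ (Submodule.subset_span (by simp)), hin _ (Submodule.subset_span (by simp))⟩
    obtain ⟨e, he, he'⟩ := ih Uᗮ (Uᗮ.compress X) (Uᗮ.compress Y) hWn (hX.compress _)
      (hY.compress _) (by
        intro w hw0 p' q' hpq' hw
        rw [Submodule.inner_compress, Submodule.inner_compress]
        refine h w (by simpa using hw0) p' q' hpq' (htop _ ?_ ?_)
        · intro u hu
          have := congrArg (inner ℂ (⟨u, hu⟩ : Uᗮ)) hw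
          rwa [inner_add_right, inner_smul_right, inner_smul_right, Submodule.inner_compress,
            Submodule.inner_compress, inner_zero_right, ← inner_smul_right, ← inner_smul_right,
            ← inner_add_right] at this
        · have hw' := (hmem w).1 w.2
          rw [inner_add_right, inner_smul_right, inner_smul_right, ← hX v w, ← hY v w, hw'.1,
            hw'.2]
          simp)
    simp only [Submodule.inner_compress] at he he'
    have hev : ∀ i, (inner ℂ v (X (e i)) = 0 ∧ inner ℂ v (Y (e i)) = 0) ∧
        inner ℂ (e i : V) (X v) = 0 ∧ inner ℂ (e i : V) (Y v) = 0 := fun i => by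
      have h1 := (hmem (e i)).1 (e i).2
      refine ⟨⟨by rw [← hX]; exact h1.1, by rw [← hY]; exact h1.2⟩, ?_, ?_⟩
      · rw [← inner_conj_symm, h1.1, map_zero]
      · rw [← inner_conj_symm, h1.2, map_zero]
    refine ⟨Fin.cons v fun i => (e i : V), ?_, ?_⟩
    · intro i j
      refine Fin.cases ?_ (fun i => ?_) i <;> refine Fin.cases ?_ (fun j => ?_) j
      · simp
      · intro _; simpa using (hev j).1
      · intro _; simpa using (hev i).2
      · intro hij
        have := he i j (by simpa using hij)
        simpa using this
    · intro i
      refine Fin.cases ?_ (fun i => ?_) i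
      · simpa using hviso
      · simpa using he' i

end Pencil

/-! ### Negative definite subspaces and the index of a pencil -/

section Index

variable {V : Type*} [NormedAddCommGroup V] [InnerProductSpace ℂ V]

/-- The quadratic form of `H` is negative definite on `S`. -/
def IsNegDefOn (H : V →ₗ[ℂ] V) (S : Submodule ℂ V) : Prop :=
  ∀ u ∈ S, u ≠ 0 → (inner ℂ u (H u)).re < 0

/-- Every real combination of `X` and `Y` has at least `k` nonnegative eigenvalues. -/
def PencilIndexGE (X Y : V →ₗ[ℂ] V) (k : ℕ) : Prop :=
  ∀ (α β : ℝ) (S : Submodule ℂ V), IsNegDefOn ((α : ℂ) • X + (β : ℂ) • Y) S →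
    Module.finrank ℂ S + k ≤ Module.finrank ℂ V

theorem isSymmetric_real_combination {X Y : V →ₗ[ℂ] V} (hX : X.IsSymmetric) (hY : Y.IsSymmetric)
    (α β : ℝ) : ((α : ℂ) • X + (β : ℂ) • Y).IsSymmetric :=
  (hX.smul (Complex.conj_ofReal α)).add (hY.smul (Complex.conj_ofReal β))

variable [FiniteDimensional ℂ V]

/-- Negative definiteness is an open condition, by compactness of the unit sphere of `S`. -/
theorem IsNegDefOn.exists_add_smul {H : V →ₗ[ℂ] V} {S : Submodule ℂ V} (hS : IsNegDefOn H S)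
    (G : V →ₗ[ℂ] V) : ∃ δ : ℝ, 0 < δ ∧ IsNegDefOn (H + (δ : ℂ) • G) S := by
  set K : Set V := Metric.sphere 0 1 ∩ S with hK
  have : ProperSpace V := FiniteDimensional.proper ℂ V
  have hKc : IsCompact K := (isCompact_sphere 0 1).inter_right S.closed_of_finiteDimensional
  have hcont : ∀ T : V →ₗ[ℂ] V, Continuous fun u => (inner ℂ u (T u)).re := fun T =>
    Complex.continuous_re.comp (continuous_id.inner T.continuous_of_finiteDimensional)
  obtain ⟨m, hm, hmK⟩ := hKc.exists_forall_le' (f := fun u => -(inner ℂ u (H u)).re)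
    (hcont H).neg.continuousOn (a := 0) (by
      rintro u ⟨hu1, huS⟩
      have hu0 : u ≠ 0 := by rintro rfl; simp at hu1
      have := hS u huS hu0
      linarith)
  obtain ⟨M, hM⟩ := hKc.exists_bound_of_continuousOn (hcont G).continuousOn
  have hM0 : 0 < |M| + 1 := by positivity
  refine ⟨m / (|M| + 1), by positivity, fun u huS hu0 => ?_⟩
  set δ := m / (|M| + 1) with hδ
  set u' : V := ((‖u‖⁻¹ : ℝ) : ℂ) • u with hu'
  have hnorm : 0 < ‖u‖ := norm_pos_iff.2 hu0
  have hu'K : u' ∈ K := by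
    refine ⟨?_, S.smul_mem _ huS⟩
    rw [mem_sphere_zero_iff_norm, hu', norm_smul, Complex.norm_real, Real.norm_eq_abs,
      abs_of_pos (by positivity)]
    field_simp
  have huu : u = ((‖u‖ : ℝ) : ℂ) • u' := by
    rw [hu', smul_smul, ← Complex.ofReal_mul, mul_inv_cancel₀ hnorm.ne', Complex.ofReal_one,
      one_smul]
  have hscale : ∀ (a : ℝ) (w : V) (T : V →ₗ[ℂ] V),
      (inner ℂ ((a : ℂ) • w) (T ((a : ℂ) • w))).re = a * a * (inner ℂ w (T w)).re := fun a w T => by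
    rw [map_smul, inner_smul_left, inner_smul_right, Complex.conj_ofReal, ← mul_assoc,
      ← Complex.ofReal_mul, Complex.re_ofReal_mul]
  have h1 : (inner ℂ u ((H + (δ : ℂ) • G) u)).re = ‖u‖ * ‖u‖ *
      ((inner ℂ u' (H u')).re + δ * (inner ℂ u' (G u')).re) := by
    conv_lhs => rw [huu]
    rw [hscale, LinearMap.add_apply, LinearMap.smul_apply, inner_add_right, inner_smul_right,
      Complex.add_re, Complex.re_ofReal_mul]
  rw [h1]
  refine mul_neg_of_pos_of_neg (by positivity) ?_
  have h2 := hmK u' hu'K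
  have h3 := (abs_le.1 ((Real.norm_eq_abs _).symm.trans_le (hM u' hu'K))).2
  have h4 : δ * (inner ℂ u' (G u')).re < δ * (|M| + 1) :=
    mul_lt_mul_of_pos_left (by linarith [le_abs_self M]) (by positivity)
  have h5 : δ * (|M| + 1) = m := by rw [hδ]; field_simp
  linarith

/-- An isotropic vector outside the kernel of `H` lies in a hyperbolic plane, which contains a
negative vector. As `v` is `H`-orthogonal to `S`, that plane can be chosen `H`-orthogonal to `S`
too. -/
theorem IsNegDefOn.exists_finrank_succ {H : V →ₗ[ℂ] V} (hH : H.IsSymmetric)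
    {S : Submodule ℂ V} (hS : IsNegDefOn H S) {v : V} (hv : inner ℂ v (H v) = 0)
    (hHv : H v ≠ 0) (hSv : ∀ s ∈ S, inner ℂ s (H v) = 0) :
    ∃ S' : Submodule ℂ V, IsNegDefOn H S' ∧ Module.finrank ℂ S' = Module.finrank ℂ S + 1 := by
  have hinj : Function.Injective (S.compress H) := by
    rw [injective_iff_map_eq_zero]
    intro s hs
    by_contra h0
    have h1 := hS s s.2 (by simpa using h0)
    rw [← S.inner_compress, hs, inner_zero_right] at h1
    simp at h1
  -- `H` is nondegenerate on `S`, so subtracting some `s₀` in `S` makes `H v` `H`-orthogonal to `S`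
  -- without changing its pairing with `v`.
  obtain ⟨s₀, hs₀⟩ := LinearMap.injective_iff_surjective.1 hinj
    (S.orthogonalProjectionOnto (H (H v)))
  have hs₀' : ∀ s ∈ S, inner ℂ s (H s₀) = inner ℂ s (H (H v)) := fun s hs => by
    have := S.inner_compress H ⟨s, hs⟩ s₀
    rw [hs₀, Submodule.inner_orthogonalProjectionOnto_eq_of_mem_left] at this
    exact this.symm
  set y : V := H v - s₀ with hy
  have hSy : ∀ s ∈ S, inner ℂ s (H y) = 0 := fun s hs => by
    rw [hy, map_sub, inner_sub_right, hs₀' s hs, sub_self]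
  have hvy : inner ℂ v (H y) = ((‖H v‖ ^ 2 : ℝ) : ℂ) := by
    rw [← hH, hy, inner_sub_right, ← inner_conj_symm (H v) (s₀ : V), hSv s₀ s₀.2, map_zero,
      sub_zero, inner_self_eq_norm_sq_to_K]
    simp
  have hyv : inner ℂ y (H v) = ((‖H v‖ ^ 2 : ℝ) : ℂ) := by
    rw [← inner_conj_symm, hH, hvy, Complex.conj_ofReal]
  clear_value y
  -- This value gives `z = y - (c/2) v` the form value `⟨y, Hy⟩ - c ‖Hv‖² = -1`.
  set c : ℝ := ((inner ℂ y (H y)).re + 1) / ‖H v‖ ^ 2 with hc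
  have hpos : 0 < ‖H v‖ ^ 2 := by positivity
  set z : V := y - (c / 2 : ℝ) • v with hz
  have hz' : z = y - ((c / 2 : ℝ) : ℂ) • v := by rw [hz, Complex.coe_smul]
  have hSz : ∀ s ∈ S, inner ℂ s (H z) = 0 := fun s hs => by
    rw [hz', map_sub, map_smul, inner_sub_right, inner_smul_right, hSy s hs, hSv s hs]
    simp
  have hzz : (inner ℂ z (H z)).re = -1 := by
    rw [hz', map_sub, map_smul, inner_sub_right, inner_sub_left, inner_sub_left, inner_smul_left,
      inner_smul_left, inner_smul_right, inner_smul_right, hv, hvy, hyv, Complex.conj_ofReal,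
      ← Complex.ofReal_mul]
    simp only [Complex.sub_re, Complex.ofReal_re, mul_zero, sub_zero]
    rw [hc]
    field_simp
    ring
  have hzS : z ∉ S := fun h => by
    rw [hSz z h] at hzz
    norm_num at hzz
  have hz0 : z ≠ 0 := by rintro h; exact hzS (h ▸ S.zero_mem)
  refine ⟨S ⊔ Submodule.span ℂ {z}, ?_, ?_⟩
  · intro u hu hu0
    obtain ⟨s, hs, w, hw, rfl⟩ := Submodule.mem_sup.1 hu
    obtain ⟨a, rfl⟩ := Submodule.mem_span_singleton.1 hw
    have hzs : inner ℂ z (H s) = 0 := by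
      rw [← hH, ← inner_conj_symm, hSz s hs, map_zero]
    have h1 : (inner ℂ (s + a • z) (H (s + a • z))).re =
        (inner ℂ s (H s)).re - ‖a‖ ^ 2 := by
      rw [map_add, map_smul, inner_add_right, inner_add_left, inner_add_left, inner_smul_left,
        inner_smul_left, inner_smul_right, inner_smul_right, hzs, hSz s hs, ← mul_assoc,
        mul_comm ((starRingEnd ℂ) a) a, Complex.mul_conj, Complex.normSq_eq_norm_sq]
      simp only [Complex.add_re, mul_zero, add_zero, zero_add,
        Complex.re_ofReal_mul, hzz]
      ring
    rw [h1]
    by_cases ha : a = 0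
    · have := hS s hs (by rintro rfl; simp [ha] at hu0)
      have := sq_nonneg ‖a‖
      linarith
    · have h2 : 0 < ‖a‖ ^ 2 := by positivity
      by_cases hs0 : s = 0
      · rw [hs0, inner_zero_left, Complex.zero_re]; linarith
      · have := hS s hs hs0
        linarith
  · have hdisj : S ⊓ Submodule.span ℂ {z} = ⊥ := by
      rw [← disjoint_iff, Submodule.disjoint_span_singleton' hz0]
      exact hzS
    have := Submodule.finrank_sup_add_finrank_inf_eq S (Submodule.span ℂ {z})
    rwa [hdisj, finrank_bot, add_zero, finrank_span_singleton hz0] at this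

/-- Passing to `W` costs at most two dimensions. One is recovered because a negative definite
subspace of `W` can be enlarged by one dimension in `V` using `v`. If `X v = Y v = 0`, no
enlargement is needed, as only one dimension is lost. -/
theorem PencilIndexGE.compress {X Y : V →ₗ[ℂ] V} (hX : X.IsSymmetric) (hY : Y.IsSymmetric)
    {k : ℕ} (h : PencilIndexGE X Y (k + 1)) {v : V} {p q : ℂ}
    (hpq : ¬(p = 0 ∧ q = 0)) (hv : p • X v + q • Y v = 0) (hXv : inner ℂ v (X v) = 0)
    (hYv : inner ℂ v (Y v) = 0) {W : Submodule ℂ V}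
    (hW : W = (Submodule.span ℂ {v} ⊔ Submodule.span ℂ {X v, Y v})ᗮ) :
    PencilIndexGE (W.compress X) (W.compress Y) k := by
  intro α β S hS
  set T : Submodule ℂ V := S.map W.subtype with hT
  have hTfin : Module.finrank ℂ T = Module.finrank ℂ S :=
    Submodule.finrank_map_subtype_eq W S
  have hTW : ∀ t ∈ T, inner ℂ t (X v) = 0 ∧ inner ℂ t (Y v) = 0 := by
    rintro _ ⟨s, _, rfl⟩
    have hs : (s : V) ∈ (Submodule.span ℂ {v} ⊔ Submodule.span ℂ {X v, Y v})ᗮ := hW ▸ s.2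
    rw [Submodule.mem_orthogonal'] at hs
    exact ⟨hs _ (Submodule.mem_sup_right (Submodule.subset_span (by simp))),
      hs _ (Submodule.mem_sup_right (Submodule.subset_span (by simp)))⟩
  have hTneg : IsNegDefOn ((α : ℂ) • X + (β : ℂ) • Y) T := by
    rintro _ ⟨s, hs, rfl⟩ hs0
    have h1 := hS s hs (by rintro rfl; simp at hs0)
    simp only [LinearMap.add_apply, LinearMap.smul_apply, inner_add_right, inner_smul_right,
      Submodule.inner_compress] at h1
    simpa only [LinearMap.add_apply, LinearMap.smul_apply, inner_add_right, inner_smul_right,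
      Submodule.subtype_apply] using h1
  have hWfin : Module.finrank ℂ V ≤
      Module.finrank ℂ W + 1 + Module.finrank ℂ (Submodule.span ℂ {X v, Y v}) := by
    have h1 := (Submodule.span ℂ {v} ⊔ Submodule.span ℂ {X v, Y v}).finrank_add_finrank_orthogonal
    have h2 := Submodule.finrank_add_le_finrank_add_finrank (Submodule.span ℂ {v})
      (Submodule.span ℂ {X v, Y v})
    have h3 : Module.finrank ℂ (Submodule.span ℂ {v}) ≤ 1 := by
      simpa using finrank_span_le_card (R := ℂ) ({v} : Set V)
    rw [← hW] at h1
    omega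
  by_cases h0 : X v = 0 ∧ Y v = 0
  · have h1 := h α β T hTneg
    have h2 : Module.finrank ℂ (Submodule.span ℂ {X v, Y v}) = 0 := by
      rw [h0.1, h0.2, Submodule.finrank_eq_zero, Submodule.span_eq_bot]
      simp
    omega
  have hle := finrank_span_pair_le_one hpq hv
  -- If the combination kills `v`, a small perturbation keeps it negative definite on `T` and no
  -- longer kills `v`.
  have key : ∃ α' β' : ℝ, IsNegDefOn ((α' : ℂ) • X + (β' : ℂ) • Y) T ∧
      ((α' : ℂ) • X + (β' : ℂ) • Y) v ≠ 0 := by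
    by_cases hne : ((α : ℂ) • X + (β : ℂ) • Y) v = 0
    · by_cases hX0 : X v = 0
      · have hY0 : Y v ≠ 0 := fun hY0 => h0 ⟨hX0, hY0⟩
        obtain ⟨δ, hδ, hneg⟩ := hTneg.exists_add_smul Y
        refine ⟨α, β + δ, ?_, ?_⟩
        · convert hneg using 1
          push_cast; module
        · have : (((α : ℝ) : ℂ) • X + ((β + δ : ℝ) : ℂ) • Y) v =
              ((α : ℂ) • X + (β : ℂ) • Y) v + (δ : ℂ) • Y v := by
            simp only [LinearMap.add_apply, LinearMap.smul_apply]; push_cast; module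
          rw [this, hne, zero_add]
          exact smul_ne_zero (by exact_mod_cast hδ.ne') hY0
      · obtain ⟨δ, hδ, hneg⟩ := hTneg.exists_add_smul X
        refine ⟨α + δ, β, ?_, ?_⟩
        · convert hneg using 1
          push_cast; module
        · have : (((α + δ : ℝ) : ℂ) • X + ((β : ℝ) : ℂ) • Y) v =
              ((α : ℂ) • X + (β : ℂ) • Y) v + (δ : ℂ) • X v := by
            simp only [LinearMap.add_apply, LinearMap.smul_apply]; push_cast; module
          rw [this, hne, zero_add]
          exact smul_ne_zero (by exact_mod_cast hδ.ne') hX0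
    · exact ⟨α, β, hTneg, hne⟩
  obtain ⟨α', β', hneg, hne⟩ := key
  obtain ⟨S', hS', hS'fin⟩ := hneg.exists_finrank_succ (isSymmetric_real_combination hX hY α' β')
    (by simp only [LinearMap.add_apply, LinearMap.smul_apply, inner_add_right, inner_smul_right,
      hXv, hYv, mul_zero, add_zero]) hne (by
      intro t ht
      simp only [LinearMap.add_apply, LinearMap.smul_apply, inner_add_right, inner_smul_right,
        hTW t ht, mul_zero, add_zero])
  have := h α' β' S' hS'
  omega

end Index

/-! ### Isotropic subspaces of general pencils -/

section Isotropic

theorem exists_isotropic_of_noIsotropicEigenvector {V : Type*} [NormedAddCommGroup V]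
    [InnerProductSpace ℂ V] [FiniteDimensional ℂ V] {X Y : V →ₗ[ℂ] V} (hX : X.IsSymmetric)
    (hY : Y.IsSymmetric) (hNI : NoIsotropicEigenvector X Y) {k : ℕ} (hk : PencilIndexGE X Y k) :
    ∃ L : Submodule ℂ V, Module.finrank ℂ L = k ∧
      ∀ u ∈ L, ∀ w ∈ L, inner ℂ u (X w) = 0 ∧ inner ℂ u (Y w) = 0 := by
  classical
  obtain ⟨n, hn⟩ : ∃ n, n = Module.finrank ℂ V := ⟨_, rfl⟩
  obtain ⟨e, he, he'⟩ := exists_simultaneous_diagonalization n V X Y hn.symm hX hY hNI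
  set x : Fin n → ℝ := fun i => (inner ℂ (e i) (X (e i))).re with hx
  set y : Fin n → ℝ := fun i => (inner ℂ (e i) (Y (e i))).re with hy
  have hx' : ∀ i, inner ℂ (e i) (X (e i)) = x i := fun i => (hX.coe_re_inner_self_apply _).symm
  have hy' : ∀ i, inner ℂ (e i) (Y (e i)) = y i := fun i => (hY.coe_re_inner_self_apply _).symm
  have hxy : ∀ i, ¬(x i = 0 ∧ y i = 0) := fun i => by
    have := he' i
    rw [hx', hy'] at this
    exact_mod_cast this
  set E : (Fin n → ℂ) →ₗ[ℂ] V := Fintype.linearCombination ℂ e with hE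
  have hEap : ∀ f, E f = ∑ i, f i • e i := fun f => Fintype.linearCombination_apply ℂ e f
  have hXj : ∀ f j, inner ℂ (e j) (X (E f)) = f j * x j := fun f j => by
    rw [hEap, map_sum, inner_sum, Finset.sum_eq_single j]
    · rw [map_smul, inner_smul_right, hx']
    · intro i _ hij
      rw [map_smul, inner_smul_right, (he j i hij.symm).1, mul_zero]
    · simp
  have hYj : ∀ f j, inner ℂ (e j) (Y (E f)) = f j * y j := fun f j => by
    rw [hEap, map_sum, inner_sum, Finset.sum_eq_single j]
    · rw [map_smul, inner_smul_right, hy']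
    · intro i _ hij
      rw [map_smul, inner_smul_right, (he j i hij.symm).2, mul_zero]
    · simp
  have hEl : ∀ f z, inner ℂ (E f) z = ∑ i, (starRingEnd ℂ) (f i) * inner ℂ (e i) z :=
    fun f z => by
      rw [hEap, sum_inner]
      exact Finset.sum_congr rfl fun i _ => inner_smul_left _ _ _
  have hEinj : Function.Injective E := by
    rw [injective_iff_map_eq_zero]
    intro f hf
    ext j
    have h1 := hXj f j
    have h2 := hYj f j
    rw [hf, map_zero, inner_zero_right] at h1 h2
    by_contra hne
    refine hxy j ⟨?_, ?_⟩
    · exact_mod_cast (mul_eq_zero.1 h1.symm).resolve_left hne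
    · exact_mod_cast (mul_eq_zero.1 h2.symm).resolve_left hne
  have hEsurj : Function.Surjective E := by
    rwa [← LinearMap.injective_iff_surjective_of_finrank_eq_finrank]
    simp [hn]
  have hzero : ∀ z, (∀ i, inner ℂ (e i) z = 0) → z = 0 := by
    intro z hz
    obtain ⟨f, hf⟩ := hEsurj z
    have : inner ℂ (E f) z = 0 := by rw [hEl]; simp [hz]
    rwa [hf, inner_self_eq_zero] at this
  have hanti : ∀ i j, ∀ a b : ℝ, 0 < a → 0 < b →
      ¬(a * x i + b * x j = 0 ∧ a * y i + b * y j = 0) := by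
    rintro i j a b ha hb ⟨h1, h2⟩
    by_cases hij : i = j
    · subst hij
      have hab : a + b ≠ 0 := by positivity
      refine hxy i ⟨?_, ?_⟩
      · exact (mul_eq_zero.1 (by linarith : (a + b) * x i = 0)).resolve_left hab
      · exact (mul_eq_zero.1 (by linarith : (a + b) * y i = 0)).resolve_left hab
    set f : Fin n → ℂ := Pi.single i (Real.sqrt a : ℂ) + Pi.single j (Real.sqrt b : ℂ) with hf
    have hfi : f i = Real.sqrt a := by simp [hf, hij]
    have hfj : f j = Real.sqrt b := by simp [hf, Ne.symm hij]
    have hfl : ∀ l, l ≠ i → l ≠ j → f l = 0 := fun l hli hlj => by simp [hf, hli, hlj]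
    have hsum : ∀ g : Fin n → ℝ, a * g i + b * g j = 0 →
        ∑ l, (starRingEnd ℂ) (f l) * (f l * (g l : ℂ)) = 0 := by
      intro g hg
      rw [Finset.sum_eq_add i j hij (fun l _ hl => by rw [hfl l hl.1 hl.2]; simp) (by simp)
        (by simp), hfi, hfj, Complex.conj_ofReal, Complex.conj_ofReal, ← mul_assoc, ← mul_assoc,
        ← Complex.ofReal_mul, ← Complex.ofReal_mul √b, Real.mul_self_sqrt ha.le,
        Real.mul_self_sqrt hb.le]
      exact_mod_cast hg
    -- For opposite vectors at `i` and `j`, the combination `√a e i + √b e j` is isotropic for both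
    -- forms and is killed by `y i X - x i Y`, against the assumption.
    refine hNI (E f) ?_ (y i) (-x i) ?_ ?_ ⟨?_, ?_⟩
    · intro h0
      have := congrFun ((injective_iff_map_eq_zero E).1 hEinj f h0) i
      rw [hfi, Pi.zero_apply] at this
      exact (Real.sqrt_pos.2 ha).ne' (by exact_mod_cast this)
    · rintro ⟨h3, h4⟩
      exact hxy i ⟨by exact_mod_cast neg_eq_zero.1 h4, by exact_mod_cast h3⟩
    · refine hzero _ fun l => ?_
      rw [inner_add_right, inner_smul_right, inner_smul_right, hXj, hYj]
      by_cases hli : l = i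
      · rw [hli]; ring
      by_cases hlj : l = j
      · rw [hlj]
        have h3 : y i * x j - x i * y j = 0 := by
          refine (mul_eq_zero.1 (?_ : b * _ = 0)).resolve_left hb.ne'
          linear_combination y i * h1 - x i * h2
        have h4 : (y i : ℂ) * x j - x i * y j = 0 := by exact_mod_cast h3
        linear_combination f j * h4
      · rw [hfl l hli hlj]; ring
    · rw [hEl]; simp_rw [hXj]; exact hsum x h1
    · rw [hEl]; simp_rw [hYj]; exact hsum y h2
  have hidx : ∀ α β : ℝ, (Finset.univ.filter fun i => α * x i + β * y i < 0).card + k ≤ n := by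
    intro α β
    let Φ : ({i // α * x i + β * y i < 0} → ℂ) →ₗ[ℂ] V :=
      E ∘ₗ Function.ExtendByZero.linearMap ℂ Subtype.val
    have hΦ : ∀ g, Φ g = E (Function.extend Subtype.val g 0) := fun g => rfl
    have hval : ∀ (g : {i // α * x i + β * y i < 0} → ℂ) (i : {i // α * x i + β * y i < 0}),
        Function.extend Subtype.val g 0 (i : Fin n) = g i :=
      fun g i => Subtype.val_injective.extend_apply g 0 i
    have hinj : Function.Injective Φ := by
      rw [injective_iff_map_eq_zero]
      intro g hg
      have h1 := (injective_iff_map_eq_zero E).1 hEinj _ ((hΦ g).symm.trans hg)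
      ext i
      rw [← hval g i, h1]; rfl
    have h1 := hk α β (LinearMap.range Φ) (by
      rintro _ ⟨g, rfl⟩ hg0
      set f := Function.extend Subtype.val g 0 with hf
      have h2 : inner ℂ (E f) (((α : ℂ) • X + (β : ℂ) • Y) (E f)) =
          ((∑ i, ‖f i‖ ^ 2 * (α * x i + β * y i) : ℝ) : ℂ) := by
        rw [hEl, Complex.ofReal_sum]
        refine Finset.sum_congr rfl fun i _ => ?_
        rw [LinearMap.add_apply, LinearMap.smul_apply, LinearMap.smul_apply, inner_add_right,
          inner_smul_right, inner_smul_right, hXj, hYj]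
        have h3 : (starRingEnd ℂ) (f i) * f i = ((‖f i‖ ^ 2 : ℝ) : ℂ) := by
          rw [mul_comm, Complex.mul_conj, Complex.normSq_eq_norm_sq]
        rw [Complex.ofReal_mul, ← h3]
        push_cast
        ring
      rw [hΦ, h2, Complex.ofReal_re]
      have hout : ∀ i, ¬ α * x i + β * y i < 0 → f i = 0 := fun i hi => by
        rw [hf, Function.extend_apply' _ _ _ (by rintro ⟨a, rfl⟩; exact hi a.2)]; rfl
      obtain ⟨i, hi⟩ : ∃ i, f i ≠ 0 := by
        by_contra! hcon
        exact hg0 (by rw [hΦ, ← hf, show f = 0 from funext hcon, map_zero])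
      refine Finset.sum_neg' (fun j _ => ?_) ⟨i, Finset.mem_univ _, ?_⟩
      · by_cases hj : α * x j + β * y j < 0
        · exact mul_nonpos_of_nonneg_of_nonpos (by positivity) hj.le
        · rw [hout j hj]; simp
      · have hi' : α * x i + β * y i < 0 := by
          by_contra h; exact hi (hout i h)
        exact mul_neg_of_pos_of_neg (by positivity) hi')
    rwa [← hn, LinearMap.finrank_range_of_inj hinj, Module.finrank_fintype_fun_eq_card,
      Fintype.card_subtype] at h1
  obtain ⟨L, hL, hLiso⟩ := exists_isotropic_of_diagonal x y hanti hidx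
  refine ⟨L.map E, ?_, ?_⟩
  · rw [← hL]
    exact (Submodule.equivMapOfInjective E hEinj L).finrank_eq.symm
  · rintro _ ⟨f, hf, rfl⟩ _ ⟨g, hg, rfl⟩
    obtain ⟨h1, h2⟩ := hLiso f hf g hg
    rw [hEl, hEl]
    simp_rw [hXj, hYj, ← mul_assoc]
    exact ⟨h1, h2⟩

/-- If every real combination of the symmetric operators `X` and `Y` has at least `k` nonnegative
eigenvalues, then both forms vanish on some `k`-dimensional subspace. -/
theorem exists_isotropic_of_pencilIndexGE (n : ℕ) : ∀ (V : Type*) [NormedAddCommGroup V]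
    [InnerProductSpace ℂ V] [FiniteDimensional ℂ V] (X Y : V →ₗ[ℂ] V) (k : ℕ),
    Module.finrank ℂ V = n → X.IsSymmetric → Y.IsSymmetric → PencilIndexGE X Y k →
    ∃ L : Submodule ℂ V, Module.finrank ℂ L = k ∧
      ∀ u ∈ L, ∀ w ∈ L, inner ℂ u (X w) = 0 ∧ inner ℂ u (Y w) = 0 := by
  induction n using Nat.strong_induction_on with
  | _ n ih =>
    intro V _ _ _ X Y k hn hX hY hk
    by_cases hNI : NoIsotropicEigenvector X Y
    · exact exists_isotropic_of_noIsotropicEigenvector hX hY hNI hk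
    rcases k with _ | k
    · refine ⟨⊥, finrank_bot ℂ V, fun u hu w _ => ?_⟩
      rw [(Submodule.mem_bot ℂ).1 hu]
      simp
    unfold NoIsotropicEigenvector at hNI
    push Not at hNI
    obtain ⟨v, hv0, p, q, hpq, hv, hXv, hYv⟩ := hNI
    -- Vectors of `W` are orthogonal to `X v` and `Y v`, so adjoining `v` to an isotropic subspace
    -- of `W` keeps it isotropic; orthogonality to `v` makes the sum direct.
    set W : Submodule ℂ V := (Submodule.span ℂ {v} ⊔ Submodule.span ℂ {X v, Y v})ᗮ with hW
    have hWmem : ∀ w ∈ W, inner ℂ v w = 0 ∧ inner ℂ w (X v) = 0 ∧ inner ℂ w (Y v) = 0 ∧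
        inner ℂ v (X w) = 0 ∧ inner ℂ v (Y w) = 0 := by
      intro w hw
      have hw' := hw
      rw [hW, Submodule.mem_orthogonal] at hw
      rw [hW, Submodule.mem_orthogonal'] at hw'
      have hXm : X v ∈ Submodule.span ℂ {v} ⊔ Submodule.span ℂ {X v, Y v} :=
        Submodule.mem_sup_right (Submodule.subset_span (by simp))
      have hYm : Y v ∈ Submodule.span ℂ {v} ⊔ Submodule.span ℂ {X v, Y v} :=
        Submodule.mem_sup_right (Submodule.subset_span (by simp))
      exact ⟨hw _ (Submodule.mem_sup_left (Submodule.mem_span_singleton_self v)), hw' _ hXm,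
        hw' _ hYm, by rw [← hX]; exact hw _ hXm, by rw [← hY]; exact hw _ hYm⟩
    have hvW : v ∉ W := fun h => hv0 (inner_self_eq_zero.1 (hWmem v h).1)
    have hlt : Module.finrank ℂ W < n := by
      rw [← hn]
      exact Submodule.finrank_lt fun h => hvW (h ▸ Submodule.mem_top)
    obtain ⟨L, hL, hLiso⟩ := ih _ hlt W (W.compress X) (W.compress Y) k rfl (hX.compress W)
      (hY.compress W) (hk.compress hX hY (fun h => hpq h.1 h.2) hv hXv hYv hW)
    refine ⟨L.map W.subtype ⊔ Submodule.span ℂ {v}, ?_, ?_⟩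
    · have hdisj : L.map W.subtype ⊓ Submodule.span ℂ {v} = ⊥ := by
        rw [← disjoint_iff, Submodule.disjoint_span_singleton' hv0]
        exact fun h => hvW (Submodule.map_subtype_le W L h)
      have := Submodule.finrank_sup_add_finrank_inf_eq (L.map W.subtype) (Submodule.span ℂ {v})
      rwa [hdisj, finrank_bot, add_zero, finrank_span_singleton hv0,
        Submodule.finrank_map_subtype_eq, hL] at this
    · intro u hu w hw
      obtain ⟨_, ⟨u, huL, rfl⟩, _, hu', rfl⟩ := Submodule.mem_sup.1 hu
      obtain ⟨_, ⟨w, hwL, rfl⟩, _, hw', rfl⟩ := Submodule.mem_sup.1 hw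
      obtain ⟨a, rfl⟩ := Submodule.mem_span_singleton.1 hu'
      obtain ⟨b, rfl⟩ := Submodule.mem_span_singleton.1 hw'
      have h1 := hLiso u huL w hwL
      rw [Submodule.inner_compress, Submodule.inner_compress] at h1
      have h2 := hWmem u u.2
      have h3 := hWmem w w.2
      simp only [Submodule.subtype_apply, map_add, map_smul, inner_add_left, inner_add_right,
        inner_smul_left, inner_smul_right, h1, h2, h3, hXv, hYv, mul_zero, add_zero, and_self]

end Isotropic

/-! ### A common point by Helly's theorem -/

section Helly

theorem finrank_le_finrank_inf_add {V : Type*} [AddCommGroup V] [Module ℂ V]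
    [FiniteDimensional ℂ V] {k : ℕ} {ι : Type*} (S : ι → Submodule ℂ V) (I : Finset ι)
    (hS : ∀ i ∈ I, Module.finrank ℂ V ≤ Module.finrank ℂ (S i) + k) :
    Module.finrank ℂ V ≤ Module.finrank ℂ (I.inf S : Submodule ℂ V) + I.card * k := by
  classical
  induction I using Finset.induction_on with
  | empty =>
    rw [Finset.inf_empty, finrank_top]
    exact Nat.le_add_right _ _
  | insert i I hi ih =>
    have h1 := ih fun j hj => hS j (Finset.mem_insert_of_mem hj)
    have h2 := hS i (Finset.mem_insert_self i I)
    have h3 := Submodule.finrank_sup_add_finrank_inf_eq (S i) (I.inf S)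
    have h4 := Submodule.finrank_le (S i ⊔ I.inf S)
    rw [Finset.inf_insert, Finset.card_insert_of_notMem hi, add_one_mul]
    omega

/-- A common point of the convex hulls of the values of `q` on the unit spheres of all subspaces of
codimension less than `k`, phrased through linear functionals. -/
theorem exists_common_point {V : Type*} [NormedAddCommGroup V] [InnerProductSpace ℂ V]
    [FiniteDimensional ℂ V] {F : Type*} [NormedAddCommGroup F] [NormedSpace ℝ F]
    [FiniteDimensional ℝ F] {q : V → F} (hq : Continuous q) {k : ℕ}
    (hn : (Module.finrank ℝ F + 1) * (k - 1) < Module.finrank ℂ V) :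
    ∃ p : F, ∀ (f : F →L[ℝ] ℝ) (S : Submodule ℂ V),
      Module.finrank ℂ V < Module.finrank ℂ S + k → ∃ u ∈ S, ‖u‖ = 1 ∧ f p ≤ f (q u) := by
  have : ProperSpace V := FiniteDimensional.proper ℂ V
  have : ProperSpace F := FiniteDimensional.proper ℝ F
  let ι := {S : Submodule ℂ V // Module.finrank ℂ V < Module.finrank ℂ S + k}
  set K : ι → Set V := fun S => Metric.sphere 0 1 ∩ (S.1 : Set V) with hK
  have hKc : ∀ S, IsCompact (K S) := fun S =>
    (isCompact_sphere 0 1).inter_right S.1.closed_of_finiteDimensional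
  have hmain : (⋂ S, closure (convexHull ℝ (q '' K S))).Nonempty := by
    refine Convex.helly_theorem_compact' (𝕜 := ℝ) (fun S => (convex_convexHull ℝ _).closure)
      (fun S => ?_) fun I hI => ?_
    · exact (isBounded_convexHull.2 ((hKc S).image hq).isBounded).isCompact_closure
    -- At most `dim F + 1` subspaces of codimension at most `k - 1` share a unit vector by the
    -- dimension hypothesis, and its value lies in all their hulls.
    · have h1 := finrank_le_finrank_inf_add (k := k - 1) (fun S : ι => S.1) I fun S _ => by
        have := S.2; omega
      have h2 : I.card * (k - 1) ≤ (Module.finrank ℝ F + 1) * (k - 1) :=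
        Nat.mul_le_mul_right _ hI
      have h3 : 0 < Module.finrank ℂ (I.inf (fun S : ι => S.1) : Submodule ℂ V) := by omega
      have := Module.nontrivial_of_finrank_pos h3
      obtain ⟨u, hu⟩ := exists_norm_eq (I.inf (fun S : ι => S.1) : Submodule ℂ V) zero_le_one
      refine ⟨q u, Set.mem_iInter₂.2 fun S hS => subset_closure (subset_convexHull ℝ _ ?_)⟩
      refine ⟨u, ⟨by simpa using hu, ?_⟩, rfl⟩
      exact (Finset.inf_le hS : I.inf (fun S : ι => S.1) ≤ S.1) u.2
  obtain ⟨p, hp⟩ := hmain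
  refine ⟨p, fun f S hS => ?_⟩
  by_contra! hcon
  -- Compactness gives a bound strictly below `f p`, which survives passing to the closed convex
  -- hull.
  obtain ⟨m, hm, hmK⟩ := (hKc ⟨S, hS⟩).exists_forall_le' (f := fun u => -f (q u))
    (f.continuous.comp hq).neg.continuousOn (a := -f p) (by
      rintro u ⟨hu1, huS⟩
      have := hcon u huS (by simpa using hu1)
      linarith)
  have hsub : closure (convexHull ℝ (q '' K ⟨S, hS⟩)) ⊆ {z | f z ≤ -m} := by
    refine closure_minimal (convexHull_min ?_ ?_) (isClosed_le f.continuous continuous_const)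
    · rintro _ ⟨u, hu, rfl⟩
      have := hmK u hu
      simp only [Set.mem_ofPred_eq]
      linarith
    · exact convex_halfSpace_le f.isLinear _
  have : f p ≤ -m := hsub (Set.mem_iInter.1 hp ⟨S, hS⟩)
  linarith

end Helly

/-! ### Scalar compressions of one or two operators -/

section Scalar

variable {V : Type*} [NormedAddCommGroup V] [InnerProductSpace ℂ V]

/-- The compression of `X` to `L` is a scalar operator. -/
def IsScalarOn (X : V →ₗ[ℂ] V) (L : Submodule ℂ V) : Prop :=
  ∃ a : ℂ, ∀ u ∈ L, ∀ w ∈ L, inner ℂ u (X w) = a * inner ℂ u w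

theorem isSymmetric_sub_real_smul_id {X : V →ₗ[ℂ] V} (hX : X.IsSymmetric) (a : ℝ) :
    (X - (a : ℂ) • LinearMap.id).IsSymmetric :=
  hX.sub (LinearMap.IsSymmetric.id.smul (Complex.conj_ofReal a))

theorem isScalarOn_of_inner_sub_eq_zero {X : V →ₗ[ℂ] V} {a : ℂ} {L : Submodule ℂ V}
    (h : ∀ u ∈ L, ∀ w ∈ L, inner ℂ u ((X - a • (LinearMap.id : V →ₗ[ℂ] V)) w) = 0) : IsScalarOn X L :=
  ⟨a, fun u hu w hw => by
    have := h u hu w hw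
    rwa [LinearMap.sub_apply, LinearMap.smul_apply, LinearMap.id_apply, inner_sub_right,
      inner_smul_right, sub_eq_zero] at this⟩

theorem IsScalarOn.mono {X : V →ₗ[ℂ] V} {L M : Submodule ℂ V} (h : IsScalarOn X L) (hML : M ≤ L) :
    IsScalarOn X M :=
  let ⟨a, ha⟩ := h
  ⟨a, fun u hu w hw => ha u (hML hu) w (hML hw)⟩

variable [FiniteDimensional ℂ V]

theorem continuous_re_inner_apply (X : V →ₗ[ℂ] V) :
    Continuous fun u => (inner ℂ u (X u)).re :=
  Complex.continuous_re.comp (continuous_id.inner X.continuous_of_finiteDimensional)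

theorem exists_isScalarOn_pair {X Y : V →ₗ[ℂ] V} (hX : X.IsSymmetric) (hY : Y.IsSymmetric) {k : ℕ}
    (hn : 3 * (k - 1) < Module.finrank ℂ V) :
    ∃ L : Submodule ℂ V, Module.finrank ℂ L = k ∧ IsScalarOn X L ∧ IsScalarOn Y L := by
  obtain ⟨p, hp⟩ := exists_common_point (V := V) (F := ℂ) (k := k)
    (q := fun u => ⟨(inner ℂ u (X u)).re, (inner ℂ u (Y u)).re⟩)
    (Complex.equivRealProdCLM.symm.continuous.comp
      ((continuous_re_inner_apply X).prodMk (continuous_re_inner_apply Y)))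
    (by rwa [Complex.finrank_real_complex])
  obtain ⟨L, hL, hLiso⟩ := exists_isotropic_of_pencilIndexGE _ V (X - (p.re : ℂ) • LinearMap.id)
    (Y - (p.im : ℂ) • LinearMap.id) k rfl (isSymmetric_sub_real_smul_id hX _)
    (isSymmetric_sub_real_smul_id hY _) (by
      intro α β S hS
      by_contra! hcon
      obtain ⟨u, huS, hu1, hle⟩ := hp (α • Complex.reCLM + β • Complex.imCLM) S hcon
      have h1 := hS u huS (by rintro rfl; simp at hu1)
      have h2 : inner ℂ u u = 1 := by rw [inner_self_eq_norm_sq_to_K, hu1]; simp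
      simp only [LinearMap.add_apply, LinearMap.smul_apply, LinearMap.sub_apply,
        LinearMap.id_apply, inner_add_right, inner_sub_right, inner_smul_right, h2, Complex.add_re,
        Complex.re_ofReal_mul, Complex.sub_re, mul_one, Complex.ofReal_re] at h1
      simp at hle
      linarith)
  exact ⟨L, hL, isScalarOn_of_inner_sub_eq_zero fun u hu w hw => (hLiso u hu w hw).1,
    isScalarOn_of_inner_sub_eq_zero fun u hu w hw => (hLiso u hu w hw).2⟩

/-- The second form is taken to be zero, so Helly's theorem is needed only on the line, and the
factor 3 becomes 2. -/
theorem exists_isScalarOn_single {X : V →ₗ[ℂ] V} (hX : X.IsSymmetric) {k : ℕ}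
    (hn : 2 * (k - 1) < Module.finrank ℂ V) :
    ∃ L : Submodule ℂ V, Module.finrank ℂ L = k ∧ IsScalarOn X L := by
  obtain ⟨p, hp⟩ := exists_common_point (V := V) (F := ℝ) (k := k)
    (q := fun u => (inner ℂ u (X u)).re) (continuous_re_inner_apply X)
    (by rwa [Module.finrank_self])
  obtain ⟨L, hL, hLiso⟩ := exists_isotropic_of_pencilIndexGE _ V (X - (p : ℂ) • LinearMap.id)
    0 k rfl (isSymmetric_sub_real_smul_id hX _) LinearMap.IsSymmetric.zero (by
      intro α β S hS
      by_contra! hcon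
      obtain ⟨u, huS, hu1, hle⟩ := hp (α • ContinuousLinearMap.id ℝ ℝ) S hcon
      have h1 := hS u huS (by rintro rfl; simp at hu1)
      have h2 : inner ℂ u u = 1 := by rw [inner_self_eq_norm_sq_to_K, hu1]; simp
      simp only [LinearMap.smul_apply, LinearMap.sub_apply, smul_zero, add_zero,
        LinearMap.id_apply, inner_sub_right, inner_smul_right, h2,
        Complex.re_ofReal_mul, Complex.sub_re, mul_one, Complex.ofReal_re] at h1
      simp at hle
      linarith)
  exact ⟨L, hL, isScalarOn_of_inner_sub_eq_zero fun u hu w hw => (hLiso u hu w hw).1⟩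

theorem IsScalarOn.map_subtype {X : V →ₗ[ℂ] V} {W : Submodule ℂ V} {L : Submodule ℂ W}
    (h : IsScalarOn (W.compress X) L) : IsScalarOn X (L.map W.subtype) := by
  obtain ⟨a, ha⟩ := h
  refine ⟨a, ?_⟩
  rintro _ ⟨u, hu, rfl⟩ _ ⟨w, hw, rfl⟩
  have := ha u hu w hw
  rwa [Submodule.inner_compress] at this

end Scalar

/-! ### Iteration over families of operators -/

theorem exists_isScalarOn_even (k : ℕ) (hk : 1 ≤ k) (ℓ : ℕ) : ∀ (V : Type*)
    [NormedAddCommGroup V] [InnerProductSpace ℂ V] [FiniteDimensional ℂ V] (X : ℕ → V →ₗ[ℂ] V),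
    (∀ i, (X i).IsSymmetric) → 3 ^ ℓ * (k - 1) < Module.finrank ℂ V →
    ∃ L : Submodule ℂ V, Module.finrank ℂ L = k ∧ ∀ i < 2 * ℓ, IsScalarOn (X i) L := by
  induction ℓ with
  | zero =>
    intro V _ _ _ X _ hn
    obtain ⟨L, -, hL⟩ := (⊤ : Submodule ℂ V).exists_le_finrank_eq (k := k)
      (by rw [finrank_top]; omega)
    exact ⟨L, hL, fun i hi => by omega⟩
  | succ ℓ ih =>
    intro V _ _ _ X hX hn
    -- The dimension `3 ^ ℓ * (k - 1) + 1` of `W` is the least that the induction hypothesis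
    -- accepts, and it is what the factor 3 allows.
    obtain ⟨W, hW, hW0, hW1⟩ := exists_isScalarOn_pair (hX (2 * ℓ)) (hX (2 * ℓ + 1))
      (k := 3 ^ ℓ * (k - 1) + 1) (by
        rw [pow_succ'] at hn
        rwa [Nat.add_sub_cancel, ← mul_assoc])
    obtain ⟨L, hL, hLs⟩ := ih W (fun i => W.compress (X i)) (fun i => (hX i).compress W)
      (by omega)
    refine ⟨L.map W.subtype, (Submodule.finrank_map_subtype_eq W L).trans hL, fun i hi => ?_⟩
    rcases Nat.lt_or_ge i (2 * ℓ) with h | h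
    · exact (hLs i h).map_subtype
    · obtain rfl | rfl : i = 2 * ℓ ∨ i = 2 * ℓ + 1 := by omega
      · exact hW0.mono (Submodule.map_subtype_le W L)
      · exact hW1.mono (Submodule.map_subtype_le W L)

theorem exists_isScalarOn_odd (k : ℕ) (hk : 1 ≤ k) (ℓ : ℕ) {V : Type*}
    [NormedAddCommGroup V] [InnerProductSpace ℂ V] [FiniteDimensional ℂ V] (X : ℕ → V →ₗ[ℂ] V)
    (hX : ∀ i, (X i).IsSymmetric) (hn : 2 * 3 ^ ℓ * (k - 1) < Module.finrank ℂ V) :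
    ∃ L : Submodule ℂ V, Module.finrank ℂ L = k ∧ ∀ i < 2 * ℓ + 1, IsScalarOn (X i) L := by
  obtain ⟨W, hW, hW0⟩ := exists_isScalarOn_single (hX (2 * ℓ)) (k := 3 ^ ℓ * (k - 1) + 1)
    (by rwa [Nat.add_sub_cancel, ← mul_assoc])
  obtain ⟨L, hL, hLs⟩ := exists_isScalarOn_even k hk ℓ W (fun i => W.compress (X i))
    (fun i => (hX i).compress W) (by omega)
  refine ⟨L.map W.subtype, (Submodule.finrank_map_subtype_eq W L).trans hL, fun i hi => ?_⟩
  rcases Nat.lt_or_ge i (2 * ℓ) with h | h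
  · exact (hLs i h).map_subtype
  · obtain rfl : i = 2 * ℓ := by omega
    exact hW0.mono (Submodule.map_subtype_le W L)

/-! ### From operator systems to Hermitian families and anticliques -/

/-- Closure under adjoints puts the real and imaginary parts of each element in `V`, so its
Hermitian elements span it, and `1` extends to a basis made of them. -/
theorem IsOperatorSystem.exists_hermitian_family {n : ℕ} [NeZero n]
    {V : Submodule ℂ (Matrix (Fin n) (Fin n) ℂ)} (hV : IsOperatorSystem V) {m : ℕ}
    (hm : Module.finrank ℂ V ≤ m + 1) :
    ∃ X : ℕ → Matrix (Fin n) (Fin n) ℂ, (∀ i, (X i).IsHermitian) ∧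
      V ≤ Submodule.span ℂ (insert 1 (X '' Set.Iio m)) := by
  classical
  set t : Set (Matrix (Fin n) (Fin n) ℂ) := {A | A ∈ V ∧ A.IsHermitian} with ht
  have h1 : LinearIndepOn ℂ id ({1} : Set (Matrix (Fin n) (Fin n) ℂ)) :=
    LinearIndepOn.singleton (v := id) one_ne_zero
  have h1t : ({1} : Set (Matrix (Fin n) (Fin n) ℂ)) ⊆ t := by
    rw [Set.singleton_subset_iff]
    exact ⟨hV.one_mem, Matrix.isHermitian_one⟩
  obtain ⟨b, hbt, hb1, htb, hbli⟩ := exists_linearIndepOn_id_extension h1 h1t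
  have hbV : Submodule.span ℂ b ≤ V := Submodule.span_le.2 fun A hA => (hbt hA).1
  have hVb : V ≤ Submodule.span ℂ b := by
    intro A hA
    have hAs := hV.conjTranspose_mem A hA
    have hre : ((2⁻¹ : ℂ) • (A + A.conjTranspose)) ∈ Submodule.span ℂ b := by
      refine htb ⟨V.smul_mem _ (V.add_mem hA hAs), ?_⟩
      simp [Matrix.IsHermitian, Matrix.conjTranspose_smul, add_comm]
    have him : ((2⁻¹ * Complex.I : ℂ) • (A.conjTranspose - A)) ∈ Submodule.span ℂ b := by
      refine htb ⟨V.smul_mem _ (V.sub_mem hAs hA), ?_⟩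
      simp only [Matrix.IsHermitian, Matrix.conjTranspose_smul, Matrix.conjTranspose_sub,
        Matrix.conjTranspose_conjTranspose, star_mul', RCLike.star_def, map_inv₀, Complex.conj_I,
        map_ofNat]
      module
    have hA' : A = (2⁻¹ : ℂ) • (A + A.conjTranspose) +
        Complex.I • ((2⁻¹ * Complex.I : ℂ) • (A.conjTranspose - A)) := by
      have : Complex.I * (2⁻¹ * Complex.I) = -2⁻¹ := by
        rw [mul_left_comm, Complex.I_mul_I]; ring
      rw [smul_smul, this]
      module
    rw [hA']
    exact Submodule.add_mem _ hre (Submodule.smul_mem _ _ him)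
  have hbfin : b.Finite := hbli.linearIndependent.set_finite_of_isNoetherian
  set B := hbfin.toFinset with hB
  have hBcard : B.card = Module.finrank ℂ V := by
    rw [← le_antisymm hbV hVb]
    have : LinearIndepOn ℂ id (B : Set (Matrix (Fin n) (Fin n) ℂ)) := by simpa [hB] using hbli
    have h := finrank_span_finset_eq_card this
    rw [← h, hB, Set.Finite.coe_toFinset]
  have h1B : (1 : Matrix (Fin n) (Fin n) ℂ) ∈ B := by
    rw [hB, Set.Finite.mem_toFinset]; exact hb1 rfl
  have hlist : (B.erase 1).toList.length ≤ m := by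
    rw [Finset.length_toList, Finset.card_erase_of_mem h1B, hBcard]; omega
  -- The family is padded with zero, which is Hermitian, as the basis without `1` may have fewer
  -- than `m` elements.
  refine ⟨fun i => (B.erase 1).toList.getD i 0, fun i => ?_, ?_⟩
  · rcases Nat.lt_or_ge i (B.erase 1).toList.length with h | h
    · beta_reduce
      rw [List.getD_eq_getElem _ _ h]
      have := Finset.mem_of_mem_erase (Finset.mem_toList.1 (List.getElem_mem h))
      exact (hbt (hbfin.mem_toFinset.1 this)).2
    · beta_reduce
      rw [List.getD_eq_default _ _ h]
      exact Matrix.isHermitian_zero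
  · refine hVb.trans (Submodule.span_mono fun A hA => ?_)
    by_cases hA1 : A = 1
    · exact Or.inl hA1
    · right
      have : A ∈ (B.erase 1).toList := by
        rw [Finset.mem_toList, Finset.mem_erase, hB, Set.Finite.mem_toFinset]
        exact ⟨hA1, hA⟩
      obtain ⟨i, hi, hiA⟩ := List.getElem_of_mem this
      exact ⟨i, hi.trans_le hlist, by beta_reduce; rw [List.getD_eq_getElem _ _ hi, hiA]⟩

/-- The anticlique is the orthogonal projection onto `L`; scalar compression to `L` says exactly
that `P A P` is a multiple of `P`, and `1 ∈ V` makes every multiple occur. -/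
theorem hasAnticlique_of_isScalarOn {n k : ℕ} {V : Submodule ℂ (Matrix (Fin n) (Fin n) ℂ)}
    (hV : IsOperatorSystem V) {s : Set (Matrix (Fin n) (Fin n) ℂ)}
    (hs : V ≤ Submodule.span ℂ (insert 1 s)) {L : Submodule ℂ (EuclideanSpace ℂ (Fin n))}
    (hL : Module.finrank ℂ L = k) (hLs : ∀ A ∈ s, IsScalarOn (Matrix.toEuclideanLin A) L) :
    HasAnticlique V k := by
  set Φ := Matrix.toEuclideanCLM (n := Fin n) (𝕜 := ℂ) with hΦ
  set P : Matrix (Fin n) (Fin n) ℂ := Φ.symm L.starProjection with hP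
  have hΦP : Φ P = L.starProjection := Φ.apply_symm_apply _
  have hΦinj : Function.Injective Φ := EquivLike.injective Φ
  have hLstar : IsStarProjection L.starProjection := isStarProjection_starProjection
  have hPstar : IsStarProjection P := by
    refine ⟨hΦinj ?_, hΦinj ?_⟩
    · rw [map_mul, hΦP]
      exact hLstar.isIdempotentElem
    · rw [map_star, hΦP]
      exact hLstar.isSelfAdjoint
  have hPP : P * P = P := hPstar.isIdempotentElem
  have hscalar : ∀ A ∈ s, P * A * P ∈ Submodule.span ℂ {P} := by
    intro A hA
    obtain ⟨a, ha⟩ := hLs A hA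
    rw [Submodule.mem_span_singleton]
    refine ⟨a, hΦinj ?_⟩
    rw [map_smul, map_mul, map_mul, hΦP]
    refine ContinuousLinearMap.ext fun v => ext_inner_left ℂ fun u => ?_
    have h1 := ha (L.starProjection u) (L.starProjection_apply_mem u) (L.starProjection v)
      (L.starProjection_apply_mem v)
    have h2 : ∀ x y, inner ℂ (L.starProjection x) y = inner ℂ x (L.starProjection y) :=
      fun x y => L.starProjection_isSymmetric x y
    rw [h2, h2] at h1
    have h3 : L.starProjection (L.starProjection v) = L.starProjection v :=
      L.starProjection_eq_self_iff.2 (L.starProjection_apply_mem v)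
    rw [h3] at h1
    rw [smul_apply, inner_smul_right, ← h1]
    rfl
  have hone : P * 1 * P = P := by rw [mul_one, hPP]
  have hspan : ∀ A ∈ V, P * A * P ∈ Submodule.span ℂ {P} := by
    have hle : Submodule.span ℂ (insert 1 s) ≤ (Submodule.span ℂ {P}).comap
        (LinearMap.mulRight ℂ P ∘ₗ LinearMap.mulLeft ℂ P) := by
      rw [Submodule.span_le, Set.insert_subset_iff]
      refine ⟨?_, hscalar⟩
      change P * 1 * P ∈ Submodule.span ℂ {P}
      rw [hone]
      exact Submodule.mem_span_singleton_self P
    exact fun A hA => hle (hs hA)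
  refine ⟨P, ⟨hPstar, Set.Subset.antisymm ?_ ?_⟩, ?_⟩
  · rintro _ ⟨A, hA, rfl⟩
    exact hspan A hA
  · intro B hB
    obtain ⟨a, rfl⟩ := Submodule.mem_span_singleton.1 hB
    refine ⟨a • 1, V.smul_mem a hV.one_mem, ?_⟩
    simp only
    rw [mul_smul_comm, smul_mul_assoc, hone]
  · rw [Matrix.rank_eq_finrank_range_toLin P (EuclideanSpace.basisFun (Fin n) ℂ).toBasis
      (EuclideanSpace.basisFun (Fin n) ℂ).toBasis, ← Matrix.toEuclideanLin_eq_toLin_orthonormal]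
    have h1 : Matrix.toEuclideanLin P = (L.starProjection).toLinearMap := by
      rw [← hΦP]; rfl
    rw [h1, ← hL, L.range_starProjection]

theorem mainTheorem3 (ℓ n k : ℕ) (hk : 1 ≤ k)
    (V : Submodule ℂ (Matrix (Fin n) (Fin n) ℂ)) (hV : IsOperatorSystem V) :
    (Module.finrank ℂ V ≤ 2 * ℓ + 1 → 3 ^ ℓ * (k - 1) < n → HasAnticlique V k) ∧
    (Module.finrank ℂ V ≤ 2 * ℓ + 2 → 2 * 3 ^ ℓ * (k - 1) < n → HasAnticlique V k) := by
  constructor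
  · intro hdim hn
    have : NeZero n := ⟨by omega⟩
    obtain ⟨X, hX, hVX⟩ := hV.exists_hermitian_family hdim
    obtain ⟨L, hL, hLs⟩ := exists_isScalarOn_even k hk ℓ (EuclideanSpace ℂ (Fin n))
      (fun i => Matrix.toEuclideanLin (X i))
      (fun i => Matrix.isSymmetric_toEuclideanLin_iff.2 (hX i)) (by simpa using hn)
    refine hasAnticlique_of_isScalarOn hV hVX hL ?_
    rintro _ ⟨i, hi, rfl⟩
    exact hLs i hi
  · intro hdim hn
    have : NeZero n := ⟨by omega⟩
    obtain ⟨X, hX, hVX⟩ := hV.exists_hermitian_family hdim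
    obtain ⟨L, hL, hLs⟩ := exists_isScalarOn_odd k hk ℓ (V := EuclideanSpace ℂ (Fin n))
      (fun i => Matrix.toEuclideanLin (X i))
      (fun i => Matrix.isSymmetric_toEuclideanLin_iff.2 (hX i)) (by simpa using hn)
    refine hasAnticlique_of_isScalarOn hV hVX hL ?_
    rintro _ ⟨i, hi, rfl⟩
    exact hLs i hi
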